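/- For $\mu\in\mathbb C$ and $z>0$ let $K_\mu(z)=\frac12\int_0^\infty \exp\{-\frac z2(t+\frac1t)\}\,t^{\mu}\,\frac{dt}{t}$. For $n\ge1$, $\nu=(\nu_1,\dots,\nu_n)\in\mathbb C^n$ and $y\in(\mathbb R^+)^n$ define $\widetilde W^n_\nu(y)$ (the $\rho$-shifted class one Whittaker function on $SO_{2n+1}(\mathbb R)$) recursively by $\widetilde W^1_{\nu}(y)=2K_{2\nu_1}(2\pi y_1)$ and, for $n\ge2$ and $\tilde\nu=(\nu_1,\dots,\nu_{n-1})$, $$ \begin{aligned} \widetilde W^n_\nu(y)=\int_{(\mathbb R^+)^n}\int_{(\mathbb R^+)^{n-1}}&\prod_{i=1}^n \exp\Bigl\{-(\pi y_i)^2t_i-\frac1{t_i}\Bigr\}\prod_{i=1}^n(\pi y_i)^{2\nu_n}\prod_{i=1}^{n-1}\exp\Bigl\{-(\pi y_i)^2\frac{t_i}{t_{i+1}}u_i-\frac1{u_i}\Bigr\}\\ &\cdot t_1^{2\nu_n}\prod_{i=1}^{n-1}(t_{i+1}u_i)^{\nu_n}\cdot\widetilde W^{n-1}_{\tilde\nu}(z_1,\dots,z_{n-1})\prod_{i=1}^{n-1}\frac{du_i}{u_i}\prod_{i=1}^n\frac{dt_i}{t_i},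 \end{aligned} $$ where $z_j=y_{j+1}\sqrt{\dfrac{t_{j+1}u_{j+1}}{t_{j+2}u_j}}$ for $1\le j\le n-1$, with $u_n=t_{n+1}=1$. Let $$ T^n_\nu(s)=\int_{(\mathbb R^+)^n}\widetilde W^n_\nu(y)\prod_{i=1}^n(\pi y_i)^{2s_i}\,\frac{dy_i}{y_i}\qquad(s\in\mathbb C^n). $$ **Theorem.** (a) If $\nu_1,s_1\in\mathbb C$ and $\mathrm{Re}(s_1)>|\mathrm{Re}(\nu_1)|$, then the integral $T^1_\nu(s)$ converges absolutely and $T^1_\nu(s)=\frac12\Gamma(s_1+\nu_1)\Gamma(s_1-\nu_1)$. (b) Let $n\ge2$, $\nu\in\mathbb C^n$, and fix real numbers $\tau_j$ $(1\le j\le n-1)$ with $$ \tau_j<\min\Bigl\{\mathrm{Re}\Bigl(\sum_{i=1}^j\varepsilon_i\nu_{\sigma(i)}\Bigr)\ \Big|\ \varepsilon_i\in\{\pm1\},\ \sigma\in\mathfrak S_n\Bigr\}. $$ Put $\tau_{-1}=\tau_n=+\infty$, $\tau_0=0$, and for $1\le j\le n$ let $$ \eta_j=\max\{-\tau_{j-1}+\mathrm{Re}(\nu_n),\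 -\tau_{j-1}-\mathrm{Re}(\nu_n),\ -\tau_j,\ -\tau_{j-2}\}, $$ $$ \Omega=\{s\in\mathbb C^n\mid\mathrm{Re}(s_j)>\eta_j\text{ for }1\le j\le n\}. $$ Then the integral $T^{n-1}_{\tilde\nu}(-t_1,\dots,-t_{n-1})$ converges absolutely whenever $\mathrm{Re}(t_j)=\tau_j$ for all $j$, and for every $s\in\Omega$ the integral $T^n_\nu(s)$ and the integral on the right below converge absolutely and, with $t_0=0$, $$ \begin{aligned} T^n_\nu(s)=\frac{2^{-1}}{(2\pi\sqrt{-1})^{n-1}}\int_{\tau_1-\sqrt{-1}\infty}^{\tau_1+\sqrt{-1}\infty}\!\!\cdots\int_{\tau_{n-1}-\sqrt{-1}\infty}^{\tau_{n-1}+\sqrt{-1}\infty}&\prod_{i=1}^n\Gamma(s_i+t_{i-1}+\nu_n)\Gamma(s_i+t_{i-1}-\nu_n)\\ &\cdot\prod_{i=1}^{n-1}\frac{\Gamma(s_i+t_i)\Gamma(s_{i+1}+t_{i-1})}{\Gamma(s_i+s_{i+1}+t_{i-1}+t_i)}\cdot T^{n-1}_{\tilde\nu}(-t_1,\dots,-t_{n-1})\prod_{i=1}^{n-1}dt_i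 . \end{aligned} $$ -/

import Mathlib

open MeasureTheory

noncomputable section

/-- The open positive orthant `(ℝ⁺)^m`. -/
def posOrthant (m : ℕ) : Set (Fin m → ℝ) := {t | ∀ i, 0 < t i}

/-- The modified Bessel function
`K_μ(z) = 2⁻¹ ∫_0^∞ exp (-(z / 2) (t + 1 / t)) t ^ μ dt / t` for `z > 0`. -/
def besselK (μ : ℂ) (z : ℝ) : ℂ :=
  2⁻¹ * ∫ t in Set.Ioi (0 : ℝ), (Real.exp (-(z / 2) * (t + 1 / t)) : ℂ) * (t : ℂ) ^ μ / (t : ℂ)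

/-- The `ρ`-shifted class one Whittaker function on `SO_{2n+1}(ℝ)`, for `y ∈ (ℝ⁺)^n`, defined by
recursion on the rank `n ≥ 1` (the value at `n = 0` is a dummy that is never used).
Indices are zero-based. In the recursive step the rank is `n + 2`; the lower rank function is
evaluated at `y_{j+1} √(t_{j+1} u_{j+1} / (t_{j+2} u_j))`, where `t` and `u` are
extended by one further entry equal to `1`, which gives the last argument its special form. -/
def whittaker : (n : ℕ) → (Fin n → ℂ) → (Fin n → ℝ) → ℂ
  | 0, _, _ => 1
  | 1, ν, y => 2 * besselK (2 * ν 0) (2 * Real.pi * y 0)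
  | n + 2, ν, y =>
    ∫ t in posOrthant (n + 2), ∫ u in posOrthant (n + 1),
      (∏ i : Fin (n + 2), (Real.exp (-(Real.pi * y i) ^ 2 * t i - 1 / t i) : ℂ))
      * (∏ i : Fin (n + 2), ((Real.pi * y i : ℝ) : ℂ) ^ (2 * ν (Fin.last (n + 1))))
      * (∏ i : Fin (n + 1),
          (Real.exp (-(Real.pi * y i.castSucc) ^ 2 * (t i.castSucc / t i.succ) * u i
            - 1 / u i) : ℂ))
      * (t 0 : ℂ) ^ (2 * ν (Fin.last (n + 1)))
      * (∏ i : Fin (n + 1), ((t i.succ * u i : ℝ) : ℂ) ^ ν (Fin.last (n + 1)))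
      * whittaker (n + 1) (fun i => ν i.castSucc)
          (fun j => y j.succ *
            Real.sqrt ((t j.succ * Fin.snoc (α := fun _ => ℝ) u 1 j.succ)
              / (Fin.snoc (α := fun _ => ℝ) t 1 j.succ.succ * u j)))
      * (∏ i : Fin (n + 1), ((u i : ℂ))⁻¹)
      * (∏ i : Fin (n + 2), ((t i : ℂ))⁻¹)

/-- The integrand (with respect to Lebesgue measure) of the multiple Mellin transform. -/
def mellinIntegrand (n : ℕ) (ν s : Fin n → ℂ) (y : Fin n → ℝ) : ℂ :=
  whittaker n ν y * ∏ i, (((Real.pi * y i : ℝ) : ℂ) ^ (2 * s i) * ((y i : ℂ))⁻¹)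

/-- Absolute convergence of the integral defining `T_ν^n(s)`. -/
def WhittakerMellinConvergent (n : ℕ) (ν s : Fin n → ℂ) : Prop :=
  IntegrableOn (mellinIntegrand n ν s) (posOrthant n)

/-- The multiple Mellin transform `T_ν^n(s)`. -/
def whittakerMellin (n : ℕ) (ν s : Fin n → ℂ) : ℂ :=
  ∫ y in posOrthant n, mellinIntegrand n ν s y

/-- The region `Ω` of those `s ∈ ℂ^{n+2}`, for the rank `n + 2`. Here `τ_0 = 0` is prepended to `τ`;
the bounds that would involve `τ_{-1}` or `τ_{n+2}` are absent. -/
def mellinRegion (n : ℕ) (ν : Fin (n + 2) → ℂ) (τ : Fin (n + 1) → ℝ) : Set (Fin (n + 2) → ℂ) :=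
  {s | (∀ j : Fin (n + 2),
          -(Fin.cons 0 τ : Fin (n + 2) → ℝ) j + (ν (Fin.last (n + 1))).re < (s j).re ∧
          -(Fin.cons 0 τ : Fin (n + 2) → ℝ) j - (ν (Fin.last (n + 1))).re < (s j).re) ∧
       (∀ j : Fin (n + 1), -τ j < (s j.castSucc).re) ∧
       (∀ j : Fin (n + 1), -(Fin.cons 0 τ : Fin (n + 2) → ℝ) j.castSucc < (s j.succ).re)}

/-- The integrand of the Mellin–Barnes integral, for the rank `n + 2`; `t_0 = 0` is prepended
to `t`. -/
def barnesIntegrand (n : ℕ) (ν s : Fin (n + 2) → ℂ) (t : Fin (n + 1) → ℂ) : ℂ :=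
  (∏ i : Fin (n + 2),
      Complex.Gamma (s i + (Fin.cons 0 t : Fin (n + 2) → ℂ) i + ν (Fin.last (n + 1)))
      * Complex.Gamma (s i + (Fin.cons 0 t : Fin (n + 2) → ℂ) i - ν (Fin.last (n + 1))))
  * (∏ i : Fin (n + 1),
      Complex.Gamma (s i.castSucc + t i)
      * Complex.Gamma (s i.succ + (Fin.cons 0 t : Fin (n + 2) → ℂ) i.castSucc)
      / Complex.Gamma (s i.castSucc + s i.succ
          + (Fin.cons 0 t : Fin (n + 2) → ℂ) i.castSucc + t i))
  * whittakerMellin (n + 1) (fun i => ν i.castSucc) (fun i => -t i)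

/-- The point with real parts `τ` and imaginary parts `x`. -/
def verticalPoint {m : ℕ} (τ x : Fin m → ℝ) : Fin m → ℂ :=
  fun j => (τ j : ℂ) + (x j : ℂ) * Complex.I

/-- Absolute convergence of the multiple integral of `f` along the lines `Re t_j = τ_j`. -/
def VerticalIntegrable {m : ℕ} (τ : Fin m → ℝ) (f : (Fin m → ℂ) → ℂ) : Prop :=
  Integrable (fun x : Fin m → ℝ => f (verticalPoint τ x))

/-- The multiple integral of `f` along the upward lines `Re t_j = τ_j`; each `dt_j = i dx_j`. -/
def verticalIntegral {m : ℕ} (τ : Fin m → ℝ) (f : (Fin m → ℂ) → ℂ) : ℂ :=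
  Complex.I ^ m * ∫ x : Fin m → ℝ, f (verticalPoint τ x)

end

/-! In the Mellin transform of the recursion, the exponentials in each `y_i` combine to `exp(-(π
y_i)² C_i)`, with `C_i = t_i (1 + u_i/t_{i+1})` and the last coefficient equal to the last `t`.
Rescaling turns the arguments of the lower rank function into free variables `z_j = y_{j+1} √R_j`,
with `R_j = liftRatio t u j`, and the first exponential into `exp(-(π z)²)` in one further variable
`z`. The remaining exponentials still couple everything. Mellin inversion replaces each by an
integral of `Γ(w_j) Q_j^(-w_j)`, where `Q_j = (π z_j)² C_{j+1}/R_j` and `w_j = s_{j+1} + ν +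
P_{j+1}`; here `P` consists of `0` followed by the Barnes variables. This exponent leaves exactly
`(π z_j)^(-2 P_{j+1})`, so that the `z`-integral is the lower rank Mellin transform at minus the
Barnes variables. What remains is a product of powers, and it separates: `t_0` and `z` give the two
gamma factors of index `0`, and each pair `(u_j, t_{j+1})` gives an integral of `pairKernel`. The
substitution `x = u/t`, `U = 1/u + 1/t` splits the latter into a beta integral in `x` and a gamma
integral in `U`. The interchange of integrals is absolute because the modulus of the separated
kernel depends only on `Re P`, which is constant on the contour; the gamma factors of the inversion
alone supply decay along it (`LiftRegion.integrable_uncurry`).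
`LiftRegion.integrable_and_integral_eq` is the resulting theorem for an arbitrary lower rank
function. Rank one is the same theorem with no Barnes variable, starting from the constant function
`1`. Convergence in every rank follows by induction in the region where `Re s_j` exceeds the largest
sum of `j + 1` of the `|Re ν_i|`; the bounds on `τ` place the lower rank transform in that region.
-/

open MeasureTheory

/-! ### The multiplicative Haar measure on the positive reals -/

/-- The measure `dx / x` on the positive reals, as a measure on `ℝ`. -/
noncomputable def mulHaar : Measure ℝ :=
  (volume.restrict (Set.Ioi 0)).withDensity fun x => ENNReal.ofReal x⁻¹

/-- The product measure `∏ dx_i / x_i`. -/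
noncomputable def mulHaarPi (m : ℕ) : Measure (Fin m → ℝ) := Measure.pi fun _ => mulHaar

instance sigmaFinite_mulHaar : SigmaFinite mulHaar := by
  unfold mulHaar
  exact SigmaFinite.withDensity_ofReal _

instance sigmaFinite_mulHaarPi (m : ℕ) : SigmaFinite (mulHaarPi m) := by
  unfold mulHaarPi; infer_instance

theorem lintegral_mulHaar (f : ℝ → ENNReal) (hf : Measurable f) :
    ∫⁻ x, f x ∂mulHaar = ∫⁻ x in Set.Ioi 0, ENNReal.ofReal x⁻¹ * f x := by
  unfold mulHaar
  rw [lintegral_withDensity_eq_lintegral_mul _ (by fun_prop) hf]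
  rfl

theorem ae_mulHaar_pos : ∀ᵐ x ∂mulHaar, 0 < x := by
  refine (withDensity_absolutelyContinuous _ _).ae_le ?_
  exact ae_restrict_mem measurableSet_Ioi

theorem ae_mulHaarPi_pos (m : ℕ) : ∀ᵐ x ∂mulHaarPi m, ∀ i, 0 < x i := by
  rw [ae_all_iff]
  intro i
  exact (Measure.quasiMeasurePreserving_eval (fun _ : Fin m => mulHaar) i).ae ae_mulHaar_pos

theorem measurePreserving_cons {m : ℕ} (μ : Fin (m + 1) → Measure ℝ) [∀ i, SigmaFinite (μ i)] :
    MeasurePreserving (fun p : ℝ × (Fin m → ℝ) => (Fin.cons p.1 p.2 : Fin (m + 1) → ℝ))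
      ((μ 0).prod (Measure.pi fun i => μ i.succ)) (Measure.pi μ) := by
  convert! (measurePreserving_piFinSuccAbove μ 0).symm using 1
  ext p i
  refine Fin.cases ?_ (fun i => ?_) i <;> simp [MeasurableEquiv.piFinSuccAbove]

theorem lintegral_pi_prod {m : ℕ} (μ : Fin m → Measure ℝ) [∀ i, SigmaFinite (μ i)]
    (f : Fin m → ℝ → ENNReal) (hf : ∀ i, Measurable (f i)) :
    ∫⁻ x, ∏ i, f i (x i) ∂Measure.pi μ = ∏ i, ∫⁻ x, f i x ∂μ i := by
  have hmeas : ∀ {k : ℕ} (g : Fin k → ℝ → ENNReal), (∀ i, Measurable (g i)) →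
      Measurable fun x : Fin k → ℝ => ∏ i, g i (x i) := fun g hg =>
    Finset.measurable_prod _ fun i _ => (hg i).comp (measurable_pi_apply i)
  induction m with
  | zero => simp
  | succ m ih =>
    rw [← (measurePreserving_cons μ).lintegral_comp (hmeas f hf)]
    simp only [Fin.prod_univ_succ, Fin.cons_zero, Fin.cons_succ]
    rw [← ih _ _ fun i => hf i.succ]
    exact lintegral_prod_mul (μ := μ 0) (ν := Measure.pi fun i => μ i.succ) (f := f 0) (g := fun x : Fin m → ℝ => ∏ i, f i.succ (x i))
      (hf 0).aemeasurable (hmeas _ fun i => hf i.succ).aemeasurable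

theorem mulHaarPi_eq_withDensity (m : ℕ) :
    mulHaarPi m = (volume.restrict (posOrthant m)).withDensity
      fun x => ∏ i, ENNReal.ofReal (x i)⁻¹ := by
  have hpos : posOrthant m = Set.univ.pi fun _ => Set.Ioi (0 : ℝ) := by
    ext x; simp [posOrthant]
  rw [hpos, volume_pi, Measure.restrict_pi_pi]
  unfold mulHaarPi
  refine Measure.pi_eq fun s hs => ?_
  rw [withDensity_apply _ (MeasurableSet.univ_pi hs), Measure.restrict_pi_pi,
    lintegral_pi_prod _ fun _ x => ENNReal.ofReal x⁻¹]
  · refine Finset.prod_congr rfl fun i _ => ?_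
    rw [mulHaar, withDensity_apply _ (hs i)]
  · intro i; fun_prop

theorem posOrthant_smul_prod_inv {m : ℕ} (g : (Fin m → ℝ) → ℂ) {x : Fin m → ℝ}
    (hx : x ∈ posOrthant m) :
    (∏ i, ENNReal.ofReal (x i)⁻¹).toReal • g x = g x * ∏ i, ((x i : ℂ))⁻¹ := by
  rw [ENNReal.toReal_prod, Complex.real_smul, mul_comm]
  congr 1
  rw [Complex.ofReal_prod]
  refine Finset.prod_congr rfl fun i _ => ?_
  rw [ENNReal.toReal_ofReal (inv_nonneg.2 (hx i).le), Complex.ofReal_inv]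

theorem measurableSet_posOrthant (m : ℕ) : MeasurableSet (posOrthant m) := by
  have : posOrthant m = Set.univ.pi fun _ => Set.Ioi (0 : ℝ) := by
    ext x; simp [posOrthant]
  rw [this]
  exact MeasurableSet.univ_pi fun _ => measurableSet_Ioi

/-- Translates the orthant integrals of the definitions to multiplicative Haar measure, for which
scalings and inversions carry no Jacobian. -/
theorem integral_posOrthant_mul_prod_inv {m : ℕ} (g : (Fin m → ℝ) → ℂ) :
    ∫ x in posOrthant m, g x * ∏ i, ((x i : ℂ))⁻¹ = ∫ x, g x ∂mulHaarPi m := by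
  rw [mulHaarPi_eq_withDensity, integral_withDensity_eq_integral_toReal_smul]
  · exact (setIntegral_congr_fun (measurableSet_posOrthant m)
      fun x hx => posOrthant_smul_prod_inv g hx).symm
  · fun_prop
  · exact ae_of_all _ fun x => ENNReal.prod_lt_top fun i _ => ENNReal.ofReal_lt_top

theorem integrableOn_posOrthant_mul_prod_inv {m : ℕ} (g : (Fin m → ℝ) → ℂ) :
    IntegrableOn (fun x => g x * ∏ i, ((x i : ℂ))⁻¹) (posOrthant m) ↔
      Integrable g (mulHaarPi m) := by
  rw [mulHaarPi_eq_withDensity, integrable_withDensity_iff_integrable_smul' (by fun_prop)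
    (ae_of_all _ fun x => ENNReal.prod_lt_top fun i _ => ENNReal.ofReal_lt_top)]
  exact (integrableOn_congr_fun (fun x hx => posOrthant_smul_prod_inv g hx)
    (measurableSet_posOrthant m)).symm

theorem integral_mulHaar_cpow_mul (f : ℝ → ℂ) (s : ℂ) :
    ∫ x : ℝ, (x : ℂ) ^ s * f x ∂mulHaar = mellin f s := by
  rw [mulHaar, integral_withDensity_eq_integral_toReal_smul (by fun_prop)
    (ae_of_all _ fun x => ENNReal.ofReal_lt_top), mellin]
  refine setIntegral_congr_fun measurableSet_Ioi fun x (hx : 0 < x) => ?_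
  simp only [smul_eq_mul]
  rw [ENNReal.toReal_ofReal (inv_nonneg.2 hx.le), Complex.real_smul,
    Complex.cpow_sub _ _ (by exact_mod_cast hx.ne'), Complex.cpow_one]
  push_cast
  ring

theorem integrable_mulHaar_cpow_mul (f : ℝ → ℂ) (s : ℂ) :
    Integrable (fun x : ℝ => (x : ℂ) ^ s * f x) mulHaar ↔ MellinConvergent f s := by
  rw [mulHaar, integrable_withDensity_iff_integrable_smul' (by fun_prop)
    (ae_of_all _ fun x => ENNReal.ofReal_lt_top), MellinConvergent]
  refine integrableOn_congr_fun (fun x (hx : 0 < x) => ?_) measurableSet_Ioi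
  simp only [smul_eq_mul]
  rw [ENNReal.toReal_ofReal (inv_nonneg.2 hx.le), Complex.real_smul,
    Complex.cpow_sub _ _ (by exact_mod_cast hx.ne'), Complex.cpow_one]
  push_cast
  ring

theorem measurePreserving_mul_mulHaar {c : ℝ} (hc : 0 < c) :
    MeasurePreserving (fun x => x * c) mulHaar mulHaar := by
  refine ⟨by fun_prop, Measure.ext_of_lintegral _ fun f hf => ?_⟩
  rw [lintegral_map hf (by fun_prop), lintegral_mulHaar _ (by fun_prop), lintegral_mulHaar _ hf]
  have himage : (fun x => x * c) '' Set.Ioi 0 = Set.Ioi 0 := by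
    ext x
    refine ⟨?_, fun hx => ⟨x / c, div_pos hx hc, by field_simp⟩⟩
    rintro ⟨y, hy, rfl⟩
    exact mul_pos hy hc
  conv_rhs => rw [← himage]
  rw [lintegral_image_eq_lintegral_abs_deriv_mul measurableSet_Ioi
    (f' := fun _ => c) (fun x _ => by simpa using ((hasDerivAt_id x).mul_const c).hasDerivWithinAt)
    (mul_left_injective₀ hc.ne').injOn]
  refine setLIntegral_congr_fun measurableSet_Ioi fun x (hx : 0 < x) => ?_
  rw [← mul_assoc, ← ENNReal.ofReal_mul (abs_nonneg c), abs_of_pos hc]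
  congr 2
  field_simp

theorem measurePreserving_inv_mulHaar :
    MeasurePreserving (fun x : ℝ => x⁻¹) mulHaar mulHaar := by
  refine ⟨by fun_prop, Measure.ext_of_lintegral _ fun f hf => ?_⟩
  rw [lintegral_map hf (by fun_prop), lintegral_mulHaar _ (by fun_prop), lintegral_mulHaar _ hf]
  have himage : (fun x : ℝ => x⁻¹) '' Set.Ioi 0 = Set.Ioi 0 := by
    rw [Set.image_inv_eq_inv]; ext; simp
  conv_rhs => rw [← himage]
  rw [lintegral_image_eq_lintegral_abs_deriv_mul measurableSet_Ioi
    (f' := fun x => -(x ^ 2)⁻¹) (fun x (hx : 0 < x) => (hasDerivAt_inv hx.ne').hasDerivWithinAt)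
    inv_injective.injOn]
  refine setLIntegral_congr_fun measurableSet_Ioi fun x (hx : 0 < x) => ?_
  rw [← mul_assoc, ← ENNReal.ofReal_mul (abs_nonneg _), abs_neg, abs_of_pos (by positivity)]
  congr 2
  field_simp

theorem measurePreserving_mul_mulHaarPi {m : ℕ} {c : Fin m → ℝ} (hc : ∀ i, 0 < c i) :
    MeasurePreserving (fun (x : Fin m → ℝ) i => x i * c i) (mulHaarPi m) (mulHaarPi m) :=
  measurePreserving_pi _ _ fun i => measurePreserving_mul_mulHaar (hc i)

/-! ### Gamma and beta integrals -/

theorem ofReal_cpow_mul_mul {x y : ℝ} (hx : 0 < x) (hy : 0 < y) (s : ℂ) :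
    ((x * y : ℝ) : ℂ) ^ s = (x : ℂ) ^ s * (y : ℂ) ^ s := by
  rw [Complex.ofReal_mul, Complex.mul_cpow_ofReal_nonneg hx.le hy.le]

theorem ofReal_cpow_inv {x : ℝ} (hx : 0 < x) (s : ℂ) :
    ((x⁻¹ : ℝ) : ℂ) ^ s = (x : ℂ) ^ (-s) := by
  rw [Complex.ofReal_inv, Complex.inv_cpow_eq_ite, if_neg, Complex.cpow_neg]
  rw [Complex.arg_ofReal_of_nonneg hx.le]
  exact Real.pi_pos.ne

theorem ofReal_cpow_div {x y : ℝ} (hx : 0 < x) (hy : 0 < y) (s : ℂ) :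
    ((x / y : ℝ) : ℂ) ^ s = (x : ℂ) ^ s * (y : ℂ) ^ (-s) := by
  rw [div_eq_mul_inv, ofReal_cpow_mul_mul hx (inv_pos.2 hy), ofReal_cpow_inv hy]

theorem ofReal_cpow_add {x : ℝ} (hx : 0 < x) (s t : ℂ) :
    (x : ℂ) ^ (s + t) = (x : ℂ) ^ s * (x : ℂ) ^ t :=
  Complex.cpow_add _ _ (by exact_mod_cast hx.ne')

theorem ofReal_sq_cpow {x : ℝ} (hx : 0 < x) (s : ℂ) :
    ((x ^ 2 : ℝ) : ℂ) ^ s = (x : ℂ) ^ (2 * s) := by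
  rw [pow_two, ofReal_cpow_mul_mul hx hx, ← ofReal_cpow_add hx, two_mul]

theorem ofReal_cpow_ne_zero {x : ℝ} (hx : 0 < x) (s : ℂ) : (x : ℂ) ^ s ≠ 0 := by
  rw [Ne, Complex.cpow_eq_zero_iff, not_and_or]
  exact Or.inl (by exact_mod_cast hx.ne')

theorem mellinConvergent_exp_neg {a : ℂ} (ha : 0 < a.re) :
    MellinConvergent (fun x : ℝ => (Real.exp (-x) : ℂ)) a := by
  refine (Complex.GammaIntegral_convergent ha).congr (ae_of_all _ fun x => ?_)
  simp [mul_comm]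

theorem mellin_exp_neg {a : ℂ} (ha : 0 < a.re) :
    mellin (fun x : ℝ => (Real.exp (-x) : ℂ)) a = Complex.Gamma a := by
  rw [Complex.Gamma_eq_integral ha, Complex.GammaIntegral_eq_mellin]

theorem integrable_cpow_neg_mul_exp_neg_inv {a : ℂ} (ha : 0 < a.re) :
    Integrable (fun t : ℝ => (t : ℂ) ^ (-a) * (Real.exp (-(1 / t)) : ℂ)) mulHaar := by
  have h := ((integrable_mulHaar_cpow_mul _ a).2 (mellinConvergent_exp_neg ha))
  refine (measurePreserving_inv_mulHaar.integrable_comp_of_integrable h).congr ?_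
  filter_upwards [ae_mulHaar_pos] with t ht
  simp only [Function.comp_apply, ofReal_cpow_inv ht, one_div]

theorem integral_cpow_neg_mul_exp_neg_inv {a : ℂ} (ha : 0 < a.re) :
    ∫ t : ℝ, (t : ℂ) ^ (-a) * (Real.exp (-(1 / t)) : ℂ) ∂mulHaar = Complex.Gamma a := by
  rw [integral_mulHaar_cpow_mul, ← mellin_exp_neg ha, ← mellin_comp_inv]
  simp

theorem integrable_cpow_mul_exp_neg_sq {a : ℂ} (ha : 0 < a.re) :
    Integrable (fun y : ℝ => ((Real.pi * y : ℝ) : ℂ) ^ (2 * a) *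
      (Real.exp (-(Real.pi * y) ^ 2) : ℂ)) mulHaar := by
  have h : Integrable (fun y : ℝ => (y : ℂ) ^ (2 * a) * (Real.exp (-y ^ 2) : ℂ)) mulHaar := by
    rw [integrable_mulHaar_cpow_mul (fun y => (Real.exp (-y ^ 2) : ℂ))]
    have := (MellinConvergent.comp_rpow (f := fun x : ℝ => (Real.exp (-x) : ℂ)) (s := 2 * a)
      (a := 2) two_ne_zero).2 (by simpa using mellinConvergent_exp_neg ha)
    simpa using this
  refine ((measurePreserving_mul_mulHaar Real.pi_pos).integrable_comp_of_integrable h).congr ?_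
  exact ae_of_all _ fun y => by simp [mul_comm]

theorem integral_cpow_mul_exp_neg_sq {a : ℂ} (ha : 0 < a.re) :
    ∫ y : ℝ, ((Real.pi * y : ℝ) : ℂ) ^ (2 * a) * (Real.exp (-(Real.pi * y) ^ 2) : ℂ) ∂mulHaar
      = 2⁻¹ * Complex.Gamma a := by
  have h : ∫ y : ℝ, (y : ℂ) ^ (2 * a) * (Real.exp (-y ^ 2) : ℂ) ∂mulHaar
      = 2⁻¹ * Complex.Gamma a := by
    rw [integral_mulHaar_cpow_mul (fun y => (Real.exp (-y ^ 2) : ℂ)), ← mellin_exp_neg ha]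
    have := mellin_comp_rpow (fun x : ℝ => (Real.exp (-x) : ℂ)) (2 * a) 2
    simpa using this
  rw [← h]
  conv_rhs => rw [← (measurePreserving_mul_mulHaar Real.pi_pos).map_eq]
  rw [integral_map (by fun_prop) (by fun_prop)]
  simp [mul_comm]

/-! ### Gamma on vertical lines and Mellin inversion of the exponential -/

theorem continuous_Gamma_vertical {a : ℂ} (ha : 0 < a.re) :
    Continuous fun x : ℝ => Complex.Gamma (a + x * Complex.I) := by
  rw [continuous_iff_continuousAt]
  intro x
  have h : ContinuousAt Complex.Gamma (a + x * Complex.I) := by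
    refine Complex.continuousAt_Gamma _ fun m h => ?_
    have := congrArg Complex.re h
    simp at this
    have : (0 : ℝ) ≤ m := by positivity
    linarith
  exact ContinuousAt.comp (f := fun x : ℝ => a + x * Complex.I) h (by fun_prop)

theorem norm_Gamma_le {a : ℂ} (ha : 0 < a.re) : ‖Complex.Gamma a‖ ≤ Real.Gamma a.re := by
  rw [Complex.Gamma_eq_integral ha, Complex.GammaIntegral, Real.Gamma_eq_integral ha]
  refine (norm_integral_le_integral_norm _).trans_eq ?_
  refine setIntegral_congr_fun measurableSet_Ioi fun x (hx : 0 < x) => ?_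
  rw [norm_mul, Complex.norm_cpow_eq_rpow_re_of_pos hx, Complex.norm_real, Real.norm_eq_abs,
    abs_of_pos (Real.exp_pos _)]
  simp

/-- Two steps of the functional equation give `|Γ(z)| = |Γ(z + 2)| / (|z| |z + 1|)`, and `Γ(z + 2)`
is bounded on the line; quadratic decay suffices for integrability. -/
theorem integrable_Gamma_vertical {a : ℂ} (ha : 0 < a.re) :
    Integrable fun x : ℝ => Complex.Gamma (a + x * Complex.I) := by
  suffices h : Integrable fun x : ℝ => Complex.Gamma ((a.re : ℂ) + x * Complex.I) by
    refine (h.comp_add_right a.im).congr (ae_of_all _ fun x => ?_)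
    simp only
    congr 1
    conv_rhs => rw [← Complex.re_add_im a]
    push_cast
    ring
  set c := a.re with hc
  -- The constant comes from `c² + x² ≥ min(1, c²) (1 + x²)`, which compares `|z|²` with `1 + x²`.
  have hk : 0 < min 1 (c ^ 2) := lt_min one_pos (by positivity)
  refine ((integrable_inv_one_add_sq.const_mul (Real.Gamma (c + 2) / min 1 (c ^ 2)))).mono'
    (continuous_Gamma_vertical (a := (c : ℂ)) (by simpa using ha)).aestronglyMeasurable
    (ae_of_all _ fun x => ?_)
  set z : ℂ := (c : ℂ) + x * Complex.I with hz
  have hzre : z.re = c := by simp [hz]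
  have hzim : z.im = x := by simp [hz]
  have hz0 : z ≠ 0 := fun h => by rw [h] at hzre; simp at hzre; linarith
  have hz1 : z + 1 ≠ 0 := fun h => by
    have := congrArg Complex.re h; simp [hzre] at this; linarith
  have hG : Complex.Gamma (z + 2) = (z + 1) * (z * Complex.Gamma z) := by
    rw [← Complex.Gamma_add_one _ hz0, ← Complex.Gamma_add_one _ hz1]; ring_nf
  have hb : ‖Complex.Gamma (z + 2)‖ ≤ Real.Gamma (c + 2) := by
    have := norm_Gamma_le (a := z + 2) (by simp [hzre]; linarith)
    simpa [hzre] using this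
  have hle : ‖z‖ ≤ ‖z + 1‖ := by
    refine abs_le_of_sq_le_sq' ?_ (norm_nonneg _) |>.2
    rw [Complex.sq_norm, Complex.sq_norm, Complex.normSq_apply, Complex.normSq_apply]
    simp [hzre, hzim]
    nlinarith
  have hsq : min 1 (c ^ 2) * (1 + x ^ 2) ≤ ‖z‖ * ‖z + 1‖ := by
    calc min 1 (c ^ 2) * (1 + x ^ 2) ≤ c ^ 2 + x ^ 2 := by
          nlinarith [min_le_left 1 (c ^ 2), min_le_right 1 (c ^ 2), sq_nonneg x]
      _ = ‖z‖ * ‖z‖ := by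
          rw [← pow_two, Complex.sq_norm, Complex.normSq_apply, hzre, hzim]; ring
      _ ≤ ‖z‖ * ‖z + 1‖ := by gcongr
  rw [hG, norm_mul, norm_mul] at hb
  rw [div_mul_eq_mul_div, le_div_iff₀ hk, ← div_eq_mul_inv, le_div_iff₀ (by positivity)]
  calc ‖Complex.Gamma z‖ * min 1 (c ^ 2) * (1 + x ^ 2)
      = ‖Complex.Gamma z‖ * (min 1 (c ^ 2) * (1 + x ^ 2)) := by ring
    _ ≤ ‖Complex.Gamma z‖ * (‖z‖ * ‖z + 1‖) := by gcongr
    _ ≤ _ := by linarith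

theorem exp_neg_eq_integral_Gamma {a : ℂ} (ha : 0 < a.re) {Q : ℝ} (hQ : 0 < Q) :
    (Real.exp (-Q) : ℂ) = (2 * (Real.pi : ℂ))⁻¹ *
      ∫ x : ℝ, Complex.Gamma (a + x * Complex.I) * (Q : ℂ) ^ (-(a + x * Complex.I)) := by
  have hm : ∀ y : ℝ, mellin (fun x : ℝ => (Real.exp (-x) : ℂ)) ((a.re : ℂ) + y * Complex.I)
      = Complex.Gamma ((a.re : ℂ) + y * Complex.I) := fun y =>
    mellin_exp_neg (by simpa using ha)
  have h := mellinInv_mellin_eq a.re (fun x : ℝ => (Real.exp (-x) : ℂ)) hQ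
    (mellinConvergent_exp_neg (by simpa using ha))
    (by
      unfold Complex.VerticalIntegrable
      simp only [hm]
      exact integrable_Gamma_vertical (by simpa using ha))
    (by fun_prop)
  -- Translating the integration variable by `Im a` moves the base point of the line from `Re a` to
  -- `a`.
  rw [← h, mellinInv]
  simp only [hm]
  rw [← integral_add_right_eq_self _ a.im, Complex.real_smul]
  push_cast
  rw [one_div]
  congr 1
  refine integral_congr_ae (ae_of_all _ fun x => ?_)
  have : (a.re : ℂ) + (x + a.im) * Complex.I = a + x * Complex.I := by
    conv_rhs => rw [← Complex.re_add_im a]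
    ring
  simp only [this, smul_eq_mul]
  ring

/-! ### Beta integrals and the integral over a pair of variables -/

/-- The change of variables `u = (1 + x) / U`, `t = (1 + x) / (U x)`. -/
theorem measurePreserving_betaMap :
    MeasurePreserving (fun p : ℝ × ℝ => (p.2⁻¹ * (1 + p.1), p.1⁻¹ * (p.2⁻¹ * (1 + p.1))))
      (mulHaar.prod mulHaar) (mulHaar.prod mulHaar) := by
  -- The map is two shears with a swap between them: for fixed `x`, `U ↦ (1 + x)/U`, then for fixed
  -- `u`, `x ↦ u/x`. Each is an inversion followed by a scaling.
  have h1 : MeasurePreserving (fun p : ℝ × ℝ => (p.1, p.2⁻¹ * (1 + p.1)))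
      (mulHaar.prod mulHaar) (mulHaar.prod mulHaar) := by
    refine (MeasurePreserving.id mulHaar).skew_product (g := fun x U => U⁻¹ * (1 + x))
      (by simp only [Function.uncurry_def]; fun_prop) ?_
    filter_upwards [ae_mulHaar_pos] with x hx
    exact ((measurePreserving_mul_mulHaar (by linarith : 0 < 1 + x)).comp
      measurePreserving_inv_mulHaar).map_eq
  have h2 : MeasurePreserving (fun p : ℝ × ℝ => (p.1, p.2⁻¹ * p.1))
      (mulHaar.prod mulHaar) (mulHaar.prod mulHaar) := by
    refine (MeasurePreserving.id mulHaar).skew_product (g := fun u x => x⁻¹ * u)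
      (by simp only [Function.uncurry_def]; fun_prop) ?_
    filter_upwards [ae_mulHaar_pos] with x hx
    exact ((measurePreserving_mul_mulHaar hx).comp measurePreserving_inv_mulHaar).map_eq
  exact h2.comp (Measure.measurePreserving_swap.comp h1)

/-- The function `exp (-1/u - 1/t) u ^ a t ^ b (1 + u/t) ^ (-A)`. -/
noncomputable def pairKernel (a b A : ℂ) (p : ℝ × ℝ) : ℂ :=
  (Real.exp (-(1 / p.1)) : ℂ) * (Real.exp (-(1 / p.2)) : ℂ) * (p.1 : ℂ) ^ a * (p.2 : ℂ) ^ b *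
    ((1 + p.1 / p.2 : ℝ) : ℂ) ^ (-A)

theorem measurable_pairKernel (a b A : ℂ) : Measurable (pairKernel a b A) := by
  unfold pairKernel; fun_prop

theorem ae_prod_mulHaar_pos : ∀ᵐ p ∂mulHaar.prod mulHaar, 0 < p.1 ∧ 0 < p.2 :=
  (Measure.quasiMeasurePreserving_fst.ae ae_mulHaar_pos).and
    (Measure.quasiMeasurePreserving_snd.ae ae_mulHaar_pos)

/-- In the new variables `u/t = x` and `1/u + 1/t = U`, so the kernel separates into a function of
`x` and a function of `U`. -/
theorem pairKernel_betaMap (a b A : ℂ) :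
    (fun p : ℝ × ℝ => pairKernel a b A (p.2⁻¹ * (1 + p.1), p.1⁻¹ * (p.2⁻¹ * (1 + p.1))))
      =ᵐ[mulHaar.prod mulHaar] fun p => ((p.1 : ℂ) ^ (-b) * ((1 + p.1 : ℝ) : ℂ) ^ (a + b - A)) *
        ((p.2 : ℂ) ^ (-(a + b)) * (Real.exp (-p.2) : ℂ)) := by
  filter_upwards [ae_prod_mulHaar_pos] with p hp
  obtain ⟨x, U⟩ := p
  obtain ⟨hx, hU⟩ : 0 < x ∧ 0 < U := hp
  have h1 : 0 < 1 + x := by linarith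
  have hdiv : 1 + U⁻¹ * (1 + x) / (x⁻¹ * (U⁻¹ * (1 + x))) = 1 + x := by field_simp
  have hexp : Real.exp (-(1 / (U⁻¹ * (1 + x)))) * Real.exp (-(1 / (x⁻¹ * (U⁻¹ * (1 + x)))))
      = Real.exp (-U) := by
    rw [← Real.exp_add]; congr 1; field_simp; ring
  simp only [pairKernel]
  rw [hdiv, ← Complex.ofReal_mul, hexp, ofReal_cpow_mul_mul (by positivity) (by positivity),
    ofReal_cpow_mul_mul (by positivity) (by positivity),
    ofReal_cpow_mul_mul (by positivity) (by positivity), ofReal_cpow_inv hU, ofReal_cpow_inv hU,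
    ofReal_cpow_inv hx, sub_eq_add_neg, ofReal_cpow_add h1, ofReal_cpow_add h1, neg_add,
    ofReal_cpow_add hU]
  ring

theorem integrable_cpow_mul_exp_neg {a : ℂ} (ha : 0 < a.re) :
    Integrable (fun x : ℝ => (x : ℂ) ^ a * (Real.exp (-x) : ℂ)) mulHaar :=
  (integrable_mulHaar_cpow_mul _ a).2 (mellinConvergent_exp_neg ha)

theorem integral_cpow_mul_exp_neg {a : ℂ} (ha : 0 < a.re) :
    ∫ x : ℝ, (x : ℂ) ^ a * (Real.exp (-x) : ℂ) ∂mulHaar = Complex.Gamma a := by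
  rw [integral_mulHaar_cpow_mul (fun x => (Real.exp (-x) : ℂ)), mellin_exp_neg ha]

theorem pairKernel_zero_eq (α β : ℂ) :
    pairKernel (-α) (-β) 0 = fun p => ((p.1 : ℂ) ^ (-α) * (Real.exp (-(1 / p.1)) : ℂ)) *
      ((p.2 : ℂ) ^ (-β) * (Real.exp (-(1 / p.2)) : ℂ)) := by
  ext p
  simp only [pairKernel, neg_zero, Complex.cpow_zero]
  ring

/-- For `A = 0` the pair kernel is a product of two gamma integrands, hence integrable; after the
change of variables almost every slice at fixed `U` is integrable and is a nonzero multiple of the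
beta integrand. -/
theorem integrable_beta {α β : ℂ} (hα : 0 < α.re) (hβ : 0 < β.re) :
    Integrable (fun x : ℝ => (x : ℂ) ^ β * ((1 + x : ℝ) : ℂ) ^ (-(α + β))) mulHaar := by
  have h : Integrable (pairKernel (-α) (-β) 0) (mulHaar.prod mulHaar) := by
    rw [pairKernel_zero_eq]
    exact (integrable_cpow_neg_mul_exp_neg_inv hα).mul_prod (integrable_cpow_neg_mul_exp_neg_inv hβ)
  have h' := (measurePreserving_betaMap.integrable_comp_of_integrable h).congr
    (pairKernel_betaMap (-α) (-β) 0)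
  -- The measure is nonzero because it gives a nonzero gamma integral; this allows a good slice to
  -- be chosen.
  have hne : (ae mulHaar).NeBot := by
    refine ae_neBot.2 fun h0 => ?_
    have := integral_cpow_mul_exp_neg (a := 1) (by simp)
    rw [h0] at this
    simp at this
  obtain ⟨U, hU, hpos⟩ := (h'.prod_left_ae.and ae_mulHaar_pos).exists
  refine (hU.mul_const ((U : ℂ) ^ (-(-α + -β)) * (Real.exp (-U) : ℂ))⁻¹).congr
    (ae_of_all _ fun x => ?_)
  have hc : (U : ℂ) ^ (-(-α + -β)) * (Real.exp (-U) : ℂ) ≠ 0 :=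
    mul_ne_zero (ofReal_cpow_ne_zero hpos _) (by exact_mod_cast (Real.exp_pos _).ne')
  simp only
  rw [mul_inv_cancel_right₀ hc]
  simp only [neg_neg, sub_zero, neg_add]

/-- Computing the integral of the kernel with `A = 0` before and after the change of variables gives
`Γ(α) Γ(β)` as the beta integral times `Γ(α + β)`. -/
theorem integral_beta {α β : ℂ} (hα : 0 < α.re) (hβ : 0 < β.re) :
    ∫ x : ℝ, (x : ℂ) ^ β * ((1 + x : ℝ) : ℂ) ^ (-(α + β)) ∂mulHaar =
      Complex.Gamma α * Complex.Gamma β / Complex.Gamma (α + β) := by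
  have hαβ : 0 < (α + β).re := by simp; linarith
  have h1 : ∫ p, pairKernel (-α) (-β) 0 p ∂mulHaar.prod mulHaar =
      Complex.Gamma α * Complex.Gamma β := by
    rw [pairKernel_zero_eq, integral_prod_mul (fun x : ℝ => (x : ℂ) ^ (-α) * (Real.exp (-(1 / x)) : ℂ))
      (fun x : ℝ => (x : ℂ) ^ (-β) * (Real.exp (-(1 / x)) : ℂ)),
      integral_cpow_neg_mul_exp_neg_inv hα, integral_cpow_neg_mul_exp_neg_inv hβ]
  rw [← measurePreserving_betaMap.map_eq, integral_map measurePreserving_betaMap.aemeasurable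
    (measurable_pairKernel _ _ _).aestronglyMeasurable,
    integral_congr_ae (pairKernel_betaMap (-α) (-β) 0),
    integral_prod_mul (fun x : ℝ => (x : ℂ) ^ (- -β) * ((1 + x : ℝ) : ℂ) ^ (-α + -β - 0))
      (fun x : ℝ => (x : ℂ) ^ (-(-α + -β)) * (Real.exp (-x) : ℂ))] at h1
  have h2 : -(-α + -β) = α + β := by ring
  have h3 : -α + -β - 0 = -(α + β) := by ring
  rw [h2, h3, neg_neg, integral_cpow_mul_exp_neg hαβ] at h1
  rw [eq_div_iff (Complex.Gamma_ne_zero_of_re_pos hαβ), h1]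

theorem integrable_pairKernel {α β γ a b A : ℂ} (hα : 0 < α.re) (hβ : 0 < β.re) (hγ : 0 < γ.re)
    (hb : b = -β) (hab : a + b = -γ) (hA : A = α + β - γ) :
    Integrable (pairKernel a b A) (mulHaar.prod mulHaar) := by
  rw [← measurePreserving_betaMap.integrable_comp (measurable_pairKernel _ _ _).aestronglyMeasurable]
  refine Integrable.congr ?_ (pairKernel_betaMap a b A).symm
  have h1 : a + b - A = -(α + β) := by rw [hab, hA]; ring
  rw [h1, hab, hb, neg_neg, neg_neg]
  exact (integrable_beta hα hβ).mul_prod (integrable_cpow_mul_exp_neg hγ)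

theorem integral_pairKernel {α β γ a b A : ℂ} (hα : 0 < α.re) (hβ : 0 < β.re) (hγ : 0 < γ.re)
    (hb : b = -β) (hab : a + b = -γ) (hA : A = α + β - γ) :
    ∫ p, pairKernel a b A p ∂mulHaar.prod mulHaar =
      Complex.Gamma α * Complex.Gamma β / Complex.Gamma (α + β) * Complex.Gamma γ := by
  rw [← measurePreserving_betaMap.map_eq, integral_map measurePreserving_betaMap.aemeasurable
    (measurable_pairKernel _ _ _).aestronglyMeasurable,
    integral_congr_ae (pairKernel_betaMap a b A)]
  have h1 : a + b - A = -(α + β) := by rw [hab, hA]; ring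
  rw [h1, hab, hb, neg_neg, neg_neg,
    integral_prod_mul (fun x : ℝ => (x : ℂ) ^ β * ((1 + x : ℝ) : ℂ) ^ (-(α + β)))
      (fun x : ℝ => (x : ℂ) ^ γ * (Real.exp (-x) : ℂ)), integral_beta hα hβ,
    integral_cpow_mul_exp_neg hγ]

/-! ### The operator raising the rank -/

/-- The integrand, with respect to `mulHaarPi`, of the recursion defining the Whittaker function,
with an arbitrary function `f` in place of the function of lower rank. -/
noncomputable def liftKernel {m : ℕ} (ν : ℂ) (f : (Fin m → ℝ) → ℂ) (y t : Fin (m + 1) → ℝ)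
    (u : Fin m → ℝ) : ℂ :=
  (∏ i : Fin (m + 1), (Real.exp (-(Real.pi * y i) ^ 2 * t i - 1 / t i) : ℂ))
  * (∏ i : Fin (m + 1), ((Real.pi * y i : ℝ) : ℂ) ^ (2 * ν))
  * (∏ i : Fin m, (Real.exp (-(Real.pi * y i.castSucc) ^ 2 * (t i.castSucc / t i.succ) * u i
        - 1 / u i) : ℂ))
  * (t 0 : ℂ) ^ (2 * ν)
  * (∏ i : Fin m, ((t i.succ * u i : ℝ) : ℂ) ^ ν)
  * f (fun j => y j.succ *
        Real.sqrt ((t j.succ * Fin.snoc (α := fun _ => ℝ) u 1 j.succ)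
          / (Fin.snoc (α := fun _ => ℝ) t 1 j.succ.succ * u j)))

/-- The rank raising operator. -/
noncomputable def whittakerLift {m : ℕ} (ν : ℂ) (f : (Fin m → ℝ) → ℂ) (y : Fin (m + 1) → ℝ) : ℂ :=
  ∫ t, ∫ u, liftKernel ν f y t u ∂mulHaarPi m ∂mulHaarPi (m + 1)

theorem whittaker_add_two (n : ℕ) (ν : Fin (n + 2) → ℂ) :
    whittaker (n + 2) ν = whittakerLift (ν (Fin.last (n + 1)))
      (whittaker (n + 1) fun i => ν i.castSucc) := by
  ext y
  rw [whittaker, whittakerLift, ← integral_posOrthant_mul_prod_inv]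
  refine integral_congr_ae (ae_of_all _ fun t => ?_)
  simp only
  rw [integral_mul_const, ← integral_posOrthant_mul_prod_inv]
  rfl

theorem measurable_snoc_apply {m : ℕ} (a : ℝ) (i : Fin (m + 1)) :
    Measurable fun x : Fin m → ℝ => (Fin.snoc x a : Fin (m + 1) → ℝ) i := by
  refine Fin.lastCases ?_ (fun i => ?_) i
  · simp
  · simpa using measurable_pi_apply i

/-- The squares of the scaling factors in the arguments of the function of lower rank. -/
noncomputable def liftRatio {m : ℕ} (t : Fin (m + 1) → ℝ) (u : Fin m → ℝ) (j : Fin m) : ℝ :=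
  (t j.succ * Fin.snoc (α := fun _ => ℝ) u 1 j.succ)
    / (Fin.snoc (α := fun _ => ℝ) t 1 j.succ.succ * u j)

theorem measurable_liftRatio {m : ℕ} (j : Fin m) :
    Measurable fun p : (Fin (m + 1) → ℝ) × (Fin m → ℝ) => liftRatio p.1 p.2 j := by
  unfold liftRatio
  have h1 := (measurable_snoc_apply (m := m) 1 j.succ).comp
    (measurable_snd : Measurable (Prod.snd : (Fin (m + 1) → ℝ) × (Fin m → ℝ) → _))
  have h2 := (measurable_snoc_apply (m := m + 1) 1 j.succ.succ).comp
    (measurable_fst : Measurable (Prod.fst : (Fin (m + 1) → ℝ) × (Fin m → ℝ) → _))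
  simp only [Function.comp_def] at h1 h2
  fun_prop

theorem measurable_liftKernel {m : ℕ} (ν : ℂ) {f : (Fin m → ℝ) → ℂ} (hf : Measurable f) :
    Measurable fun p : ((Fin (m + 1) → ℝ) × (Fin m → ℝ)) × (Fin (m + 1) → ℝ) =>
      liftKernel ν f p.2 p.1.1 p.1.2 := by
  have h : Measurable fun p : ((Fin (m + 1) → ℝ) × (Fin m → ℝ)) × (Fin (m + 1) → ℝ) =>
      f fun j => p.2 j.succ * Real.sqrt (liftRatio p.1.1 p.1.2 j) := by
    refine hf.comp (measurable_pi_iff.2 fun j => ?_)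
    have := (measurable_liftRatio j).comp
      (measurable_fst : Measurable (Prod.fst :
        ((Fin (m + 1) → ℝ) × (Fin m → ℝ)) × (Fin (m + 1) → ℝ) → _))
    simp only [Function.comp_def] at this
    fun_prop
  unfold liftKernel
  refine Measurable.mul ?_ h
  fun_prop

theorem measurable_whittakerLift {m : ℕ} (ν : ℂ) {f : (Fin m → ℝ) → ℂ} (hf : Measurable f) :
    Measurable (whittakerLift ν f) := by
  have h := (measurable_liftKernel ν hf).comp (f := fun q :
    ((Fin (m + 1) → ℝ) × (Fin (m + 1) → ℝ)) × (Fin m → ℝ) => ((q.1.2, q.2), q.1.1)) (by fun_prop)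
  have h1 := StronglyMeasurable.integral_prod_right' (ν := mulHaarPi m) h.stronglyMeasurable
  exact (StronglyMeasurable.integral_prod_right' (ν := mulHaarPi (m + 1)) h1).measurable

/-- The coefficients `t_i (1 + u_i / t_{i+1})` (the last one being `t_m`) of the quadratic
exponent. -/
noncomputable def liftCoeff {m : ℕ} (t : Fin (m + 1) → ℝ) (u : Fin m → ℝ) (i : Fin (m + 1)) : ℝ :=
  t i * (1 + Fin.snoc (α := fun _ => ℝ) (fun j => u j / t j.succ) 0 i)

theorem liftCoeff_castSucc {m : ℕ} (t : Fin (m + 1) → ℝ) (u : Fin m → ℝ) (i : Fin m) :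
    liftCoeff t u i.castSucc = t i.castSucc * (1 + u i / t i.succ) := by
  simp [liftCoeff]

theorem liftCoeff_last {m : ℕ} (t : Fin (m + 1) → ℝ) (u : Fin m → ℝ) :
    liftCoeff t u (Fin.last m) = t (Fin.last m) := by
  simp [liftCoeff]

theorem liftCoeff_pos {m : ℕ} {t : Fin (m + 1) → ℝ} {u : Fin m → ℝ} (ht : ∀ i, 0 < t i)
    (hu : ∀ i, 0 < u i) (i : Fin (m + 1)) : 0 < liftCoeff t u i := by
  refine Fin.lastCases ?_ (fun i => ?_) i
  · rw [liftCoeff_last]; exact ht _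
  · rw [liftCoeff_castSucc]
    have := ht i.succ; have := hu i; have := ht i.castSucc
    positivity

theorem measurable_liftCoeff {m : ℕ} (i : Fin (m + 1)) :
    Measurable fun p : (Fin (m + 1) → ℝ) × (Fin m → ℝ) => liftCoeff p.1 p.2 i := by
  refine Fin.lastCases ?_ (fun i => ?_) i
  · simp only [liftCoeff_last]; fun_prop
  · simp only [liftCoeff_castSucc]; fun_prop

theorem snoc_pos {m : ℕ} {x : Fin m → ℝ} (hx : ∀ i, 0 < x i) (i : Fin (m + 1)) :
    0 < (Fin.snoc x 1 : Fin (m + 1) → ℝ) i := by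
  refine Fin.lastCases ?_ (fun i => ?_) i
  · simp
  · simpa using hx i

theorem liftRatio_pos {m : ℕ} {t : Fin (m + 1) → ℝ} {u : Fin m → ℝ} (ht : ∀ i, 0 < t i)
    (hu : ∀ i, 0 < u i) (j : Fin m) : 0 < liftRatio t u j := by
  have h1 := snoc_pos hu j.succ
  have h2 := snoc_pos ht j.succ.succ
  have := ht j.succ; have := hu j
  unfold liftRatio
  positivity

/-- The part of the kernel that depends on `t` and `u` only. -/
noncomputable def liftWeight {m : ℕ} (ν : ℂ) (t : Fin (m + 1) → ℝ) (u : Fin m → ℝ) : ℂ :=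
  (∏ i, (Real.exp (-(1 / t i)) : ℂ)) * (∏ i, (Real.exp (-(1 / u i)) : ℂ)) * (t 0 : ℂ) ^ (2 * ν) *
    ∏ i : Fin m, ((t i.succ * u i : ℝ) : ℂ) ^ ν

/-- Collects the dependence on `y`: outside the lower rank function, each `y_i` enters only through
one Gaussian and one power. -/
theorem liftKernel_mul_prod_cpow {m : ℕ} (ν : ℂ) (f : (Fin m → ℝ) → ℂ) (s : Fin (m + 1) → ℂ)
    {y t : Fin (m + 1) → ℝ} (hy : ∀ i, 0 < y i) (u : Fin m → ℝ) :
    liftKernel ν f y t u * ∏ i, ((Real.pi * y i : ℝ) : ℂ) ^ (2 * s i) =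
      (∏ i, ((Real.exp (-((Real.pi * y i) ^ 2 * liftCoeff t u i)) : ℂ) *
        ((Real.pi * y i : ℝ) : ℂ) ^ (2 * (s i + ν)))) * liftWeight ν t u *
        f (fun j => y j.succ * Real.sqrt (liftRatio t u j)) := by
  have hexp : (∏ i : Fin (m + 1), (Real.exp (-(Real.pi * y i) ^ 2 * t i - 1 / t i) : ℂ)) *
      (∏ i : Fin m, (Real.exp (-(Real.pi * y i.castSucc) ^ 2 * (t i.castSucc / t i.succ) * u i
        - 1 / u i) : ℂ)) =
      (∏ i, (Real.exp (-((Real.pi * y i) ^ 2 * liftCoeff t u i)) : ℂ)) *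
        ((∏ i, (Real.exp (-(1 / t i)) : ℂ)) * ∏ i, (Real.exp (-(1 / u i)) : ℂ)) := by
    simp only [Fin.prod_univ_castSucc (n := m), liftCoeff_castSucc, liftCoeff_last]
    have h : ∀ i : Fin m,
        (Real.exp (-(Real.pi * y i.castSucc) ^ 2 * t i.castSucc - 1 / t i.castSucc) : ℂ) *
        (Real.exp (-(Real.pi * y i.castSucc) ^ 2 * (t i.castSucc / t i.succ) * u i
          - 1 / u i) : ℂ) =
        (Real.exp (-((Real.pi * y i.castSucc) ^ 2 * (t i.castSucc * (1 + u i / t i.succ)))) : ℂ) *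
        ((Real.exp (-(1 / t i.castSucc)) : ℂ) * (Real.exp (-(1 / u i)) : ℂ)) := by
      intro i
      norm_cast
      rw [← Real.exp_add, ← Real.exp_add, ← Real.exp_add]
      congr 1
      ring
    have h' := Finset.prod_congr (rfl : (Finset.univ : Finset (Fin m)) = Finset.univ)
      fun i _ => h i
    simp only [Finset.prod_mul_distrib] at h'
    have hl : (Real.exp (-(Real.pi * y (Fin.last m)) ^ 2 * t (Fin.last m)
        - 1 / t (Fin.last m)) : ℂ) =
        (Real.exp (-((Real.pi * y (Fin.last m)) ^ 2 * t (Fin.last m))) : ℂ) *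
        (Real.exp (-(1 / t (Fin.last m))) : ℂ) := by
      norm_cast
      rw [← Real.exp_add]
      congr 1
      ring
    rw [hl]
    linear_combination (Real.exp (-((Real.pi * y (Fin.last m)) ^ 2 * t (Fin.last m))) : ℂ) *
        (Real.exp (-(1 / t (Fin.last m))) : ℂ) * h'
  have hpow : (∏ i, ((Real.pi * y i : ℝ) : ℂ) ^ (2 * (s i + ν))) =
      (∏ i, ((Real.pi * y i : ℝ) : ℂ) ^ (2 * s i)) *
        ∏ i : Fin (m + 1), ((Real.pi * y i : ℝ) : ℂ) ^ (2 * ν) := by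
    rw [← Finset.prod_mul_distrib]
    refine Finset.prod_congr rfl fun i _ => ?_
    rw [mul_add, ofReal_cpow_add (mul_pos Real.pi_pos (hy i))]
  rw [Finset.prod_mul_distrib, hpow]
  unfold liftKernel liftWeight
  change _ * f (fun j => y j.succ * Real.sqrt (liftRatio t u j)) * _ = _
  linear_combination (∏ i : Fin (m + 1), ((Real.pi * y i : ℝ) : ℂ) ^ (2 * ν)) *
    (t 0 : ℂ) ^ (2 * ν) * (∏ i : Fin m, ((t i.succ * u i : ℝ) : ℂ) ^ ν) *
    f (fun j => y j.succ * Real.sqrt (liftRatio t u j)) *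
    (∏ i, ((Real.pi * y i : ℝ) : ℂ) ^ (2 * s i)) * hexp

/-- The pair kernel in the `j`-th pair of variables `(u_j, t_{j+1})`. -/
noncomputable def liftPair {m : ℕ} (ν : ℂ) (s P : Fin (m + 1) → ℂ) (j : Fin m) : ℝ × ℝ → ℂ :=
  pairKernel (ν + P j.castSucc - P j.succ) (-(s j.succ + P j.castSucc))
    (s j.castSucc + ν + P j.castSucc)

/-- The separation of variables. The coefficients and the ratios share the factors `t_i`, whose
exponents `P_i` cancel, and everything else depends on `t_0` or on a single pair `(u_j, t_{j+1})`.
-/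
theorem liftWeight_mul_prod {m : ℕ} (ν : ℂ) (s P : Fin (m + 1) → ℂ) (hP : P 0 = 0)
    {t : Fin (m + 1) → ℝ} {u : Fin m → ℝ} (ht : ∀ i, 0 < t i) (hu : ∀ i, 0 < u i) :
    liftWeight ν t u * (∏ i, (liftCoeff t u i : ℂ) ^ (-(s i + ν + P i))) *
      (∏ j, (liftRatio t u j : ℂ) ^ (P j.succ)) =
    ((t 0 : ℂ) ^ (-(s 0 - ν)) * (Real.exp (-(1 / t 0)) : ℂ)) *
      ∏ j, liftPair ν s P j (u j, t j.succ) := by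
  -- With `v_i = u_i/t_{i+1}`, and last entry `1`, the ratio is `R_j = t_{j+1} v_{j+1} / u_j`. Its
  -- numerators have the form `t_i v_i`, to be matched with the coefficients of the same index.
  set v : Fin (m + 1) → ℝ := fun i => Fin.snoc (α := fun _ => ℝ) u 1 i /
    Fin.snoc (α := fun _ => ℝ) t 1 i.succ with hv
  have hvpos : ∀ i, 0 < v i := fun i => div_pos (snoc_pos hu i) (snoc_pos ht i.succ)
  have hvc : ∀ i : Fin m, v i.castSucc = u i / t i.succ := fun i => by
    simp only [hv, Fin.snoc_castSucc, Fin.succ_castSucc]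
  have hvl : v (Fin.last m) = 1 := by
    simp only [hv, Fin.snoc_last, Fin.succ_last, div_one]
  have hR : ∀ j : Fin m, (liftRatio t u j : ℂ) ^ (P j.succ) =
      ((t j.succ * v j.succ : ℝ) : ℂ) ^ (P j.succ) * (u j : ℂ) ^ (-P j.succ) := fun j => by
    rw [← ofReal_cpow_div (mul_pos (ht _) (hvpos _)) (hu j)]
    congr 2
    simp only [liftRatio, hv]
    ring
  have hR' : (∏ j, (liftRatio t u j : ℂ) ^ (P j.succ)) =
      (∏ i, ((t i * v i : ℝ) : ℂ) ^ (P i)) * ∏ j : Fin m, (u j : ℂ) ^ (-P j.succ) := by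
    rw [Fin.prod_univ_succ (fun i => ((t i * v i : ℝ) : ℂ) ^ (P i)), hP, Complex.cpow_zero, one_mul,
      ← Finset.prod_mul_distrib]
    exact Finset.prod_congr rfl fun j _ => hR j
  have hC : (∏ i, (liftCoeff t u i : ℂ) ^ (-(s i + ν + P i))) *
      (∏ i, ((t i * v i : ℝ) : ℂ) ^ (P i)) =
      (∏ i, (t i : ℂ) ^ (-(s i + ν))) *
      ∏ i : Fin m, (((1 + u i / t i.succ : ℝ) : ℂ) ^ (-(s i.castSucc + ν + P i.castSucc)) *
        ((u i / t i.succ : ℝ) : ℂ) ^ (P i.castSucc)) := by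
    rw [← Finset.prod_mul_distrib, Fin.prod_univ_castSucc,
      Fin.prod_univ_castSucc (fun i => (t i : ℂ) ^ (-(s i + ν))), liftCoeff_last, hvl, mul_one,
      ← ofReal_cpow_add (ht _), mul_right_comm, ← Finset.prod_mul_distrib]
    congr 1
    · refine Finset.prod_congr rfl fun i _ => ?_
      have h1 : 0 < u i / t i.succ := div_pos (hu i) (ht _)
      rw [liftCoeff_castSucc, hvc, ofReal_cpow_mul_mul (ht _) (by linarith),
        ofReal_cpow_mul_mul (ht _) h1]
      have : -(s i.castSucc + ν) = -(s i.castSucc + ν + P i.castSucc) + P i.castSucc := by ring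
      rw [this, ofReal_cpow_add (ht _)]
      ring
    · congr 1; ring
  have hpair : ∀ j : Fin m, liftPair ν s P j (u j, t j.succ) =
      (Real.exp (-(1 / t j.succ)) : ℂ) * (Real.exp (-(1 / u j)) : ℂ) *
      ((t j.succ * u j : ℝ) : ℂ) ^ ν * (t j.succ : ℂ) ^ (-(s j.succ + ν)) *
      (((1 + u j / t j.succ : ℝ) : ℂ) ^ (-(s j.castSucc + ν + P j.castSucc)) *
        ((u j / t j.succ : ℝ) : ℂ) ^ (P j.castSucc)) * (u j : ℂ) ^ (-P j.succ) := fun j => by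
    have hb : -(s j.succ + P j.castSucc) = ν + -(s j.succ + ν) + -P j.castSucc := by ring
    simp only [liftPair, pairKernel]
    rw [hb, sub_eq_add_neg, ofReal_cpow_add (ht _), ofReal_cpow_add (ht _), ofReal_cpow_add (hu _),
      ofReal_cpow_add (hu _), ofReal_cpow_div (hu _) (ht _), ofReal_cpow_mul_mul (ht _) (hu _)]
    ring
  rw [Finset.prod_congr rfl fun j _ => hpair j, hR']
  simp only [Finset.prod_mul_distrib] at hC ⊢
  have h0 : (t 0 : ℂ) ^ (-(s 0 - ν)) = (t 0 : ℂ) ^ (2 * ν) * (t 0 : ℂ) ^ (-(s 0 + ν)) := by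
    rw [← ofReal_cpow_add (ht _)]; congr 1; ring
  have h1 := Fin.prod_univ_succ fun i => (Real.exp (-(1 / t i)) : ℂ)
  have h2 := Fin.prod_univ_succ fun i => (t i : ℂ) ^ (-(s i + ν))
  rw [h2] at hC
  rw [h0]
  unfold liftWeight
  rw [h1]
  linear_combination (Real.exp (-(1 / t 0)) : ℂ) * (∏ i : Fin m, (Real.exp (-(1 / t i.succ)) : ℂ)) *
    (∏ i, (Real.exp (-(1 / u i)) : ℂ)) * (t 0 : ℂ) ^ (2 * ν) *
    (∏ i : Fin m, ((t i.succ * u i : ℝ) : ℂ) ^ ν) * (∏ j : Fin m, (u j : ℂ) ^ (-P j.succ)) * hC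

/-! ### The change of variables and the Mellin–Barnes formula -/

/-- The variables `(t, u)` from `t_0` and the pairs `(u_j, t_{j+1})`. -/
def unpair {m : ℕ} (b : ℝ × (Fin m → ℝ × ℝ)) : (Fin (m + 1) → ℝ) × (Fin m → ℝ) :=
  (Fin.cons b.1 fun i => (b.2 i).2, fun i => (b.2 i).1)

/-- The measure on the variables `t_0` and `(u_j, t_{j+1})`. -/
noncomputable def pairMeasure (m : ℕ) : Measure (ℝ × (Fin m → ℝ × ℝ)) :=
  mulHaar.prod (Measure.pi fun _ => mulHaar.prod mulHaar)

instance sigmaFinite_pairMeasure (m : ℕ) : SigmaFinite (pairMeasure m) := by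
  unfold pairMeasure; infer_instance

theorem measurePreserving_cons_mulHaar (m : ℕ) :
    MeasurePreserving (fun p : ℝ × (Fin m → ℝ) => (Fin.cons p.1 p.2 : Fin (m + 1) → ℝ))
      (mulHaar.prod (mulHaarPi m)) (mulHaarPi (m + 1)) :=
  measurePreserving_cons fun _ => mulHaar

theorem measurePreserving_unpair (m : ℕ) :
    MeasurePreserving unpair (pairMeasure m) ((mulHaarPi (m + 1)).prod (mulHaarPi m)) := by
  have h1 : MeasurePreserving (Prod.map id (MeasurableEquiv.arrowProdEquivProdArrow ℝ ℝ (Fin m)))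
      (pairMeasure m) (mulHaar.prod ((mulHaarPi m).prod (mulHaarPi m))) :=
    (MeasurePreserving.id mulHaar).prod
      (measurePreserving_arrowProdEquivProdArrow ℝ ℝ (Fin m) (fun _ => mulHaar) fun _ => mulHaar)
  have h2 : MeasurePreserving (Prod.map id Prod.swap)
      (mulHaar.prod ((mulHaarPi m).prod (mulHaarPi m)))
      (mulHaar.prod ((mulHaarPi m).prod (mulHaarPi m))) :=
    (MeasurePreserving.id mulHaar).prod Measure.measurePreserving_swap
  have h3 := (measurePreserving_prodAssoc mulHaar (mulHaarPi m) (mulHaarPi m)).symm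
  have h4 := (measurePreserving_cons_mulHaar m).prod (MeasurePreserving.id (mulHaarPi m))
  exact h4.comp (h3.comp (h2.comp h1))

/-- The factors by which the variables `y` are scaled. -/
noncomputable def liftScale {m : ℕ} (q : (Fin (m + 1) → ℝ) × (Fin m → ℝ)) : Fin (m + 1) → ℝ :=
  Fin.cons (Real.sqrt (liftCoeff q.1 q.2 0))⁻¹ fun j => (Real.sqrt (liftRatio q.1 q.2 j))⁻¹

theorem measurable_liftScale {m : ℕ} (i : Fin (m + 1)) :
    Measurable fun q : (Fin (m + 1) → ℝ) × (Fin m → ℝ) => liftScale q i := by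
  have h1 := measurable_liftCoeff (m := m) 0
  refine Fin.cases ?_ (fun j => ?_) i
  · simp only [liftScale, Fin.cons_zero]; fun_prop
  · have h2 := measurable_liftRatio j
    simp only [liftScale, Fin.cons_succ]; fun_prop

theorem liftScale_pos {m : ℕ} {q : (Fin (m + 1) → ℝ) × (Fin m → ℝ)} (ht : ∀ i, 0 < q.1 i)
    (hu : ∀ i, 0 < q.2 i) (i : Fin (m + 1)) : 0 < liftScale q i := by
  have h0 := liftCoeff_pos ht hu 0
  refine Fin.cases ?_ (fun j => ?_) i
  · simp only [liftScale, Fin.cons_zero]; positivity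
  · have := liftRatio_pos ht hu j
    simp only [liftScale, Fin.cons_succ]; positivity

/-- The change of variables under which the integrand becomes a product. -/
noncomputable def liftMap {m : ℕ} (p : (ℝ × (Fin m → ℝ × ℝ)) × (ℝ × (Fin m → ℝ))) :
    ((Fin (m + 1) → ℝ) × (Fin m → ℝ)) × (Fin (m + 1) → ℝ) :=
  (unpair p.1, fun i => (Fin.cons p.2.1 p.2.2 : Fin (m + 1) → ℝ) i * liftScale (unpair p.1) i)

theorem ae_prod_mulHaarPi_pos (m : ℕ) : ∀ᵐ q ∂(mulHaarPi (m + 1)).prod (mulHaarPi m),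
    (∀ i, 0 < q.1 i) ∧ ∀ i, 0 < q.2 i :=
  (Measure.quasiMeasurePreserving_fst.ae (ae_mulHaarPi_pos _)).and
    (Measure.quasiMeasurePreserving_snd.ae (ae_mulHaarPi_pos _))

theorem ae_pairMeasure_pos (m : ℕ) : ∀ᵐ b ∂pairMeasure m,
    (∀ i, 0 < (unpair b).1 i) ∧ ∀ i, 0 < (unpair b).2 i :=
  (measurePreserving_unpair m).quasiMeasurePreserving.ae (ae_prod_mulHaarPi_pos m)

/-- A shear: for fixed `(t, u)` the map on the remaining variables is a positive scaling, which
preserves Haar measure. -/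
theorem measurePreserving_liftMap (m : ℕ) :
    MeasurePreserving liftMap ((pairMeasure m).prod (mulHaar.prod (mulHaarPi m)))
      (((mulHaarPi (m + 1)).prod (mulHaarPi m)).prod (mulHaarPi (m + 1))) := by
  refine (measurePreserving_unpair m).skew_product (g := fun b (z : ℝ × (Fin m → ℝ)) i =>
    (Fin.cons z.1 z.2 : Fin (m + 1) → ℝ) i * liftScale (unpair b) i) ?_ ?_
  · refine measurable_pi_iff.2 fun i => Measurable.mul ?_ ?_
    · exact (measurable_pi_apply i).comp
        ((measurePreserving_cons_mulHaar m).measurable.comp measurable_snd)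
    · exact (measurable_liftScale i).comp
        ((measurePreserving_unpair m).measurable.comp measurable_fst)
  · filter_upwards [ae_pairMeasure_pos m] with b hb
    exact ((measurePreserving_mul_mulHaarPi (liftScale_pos hb.1 hb.2)).comp
      (measurePreserving_cons_mulHaar m)).map_eq

/-- The Mellin–Barnes integrand on the full space of variables, where `P` is `0` followed by the
Barnes variables. -/
noncomputable def barnesKernel {m : ℕ} (ν : ℂ) (f : (Fin m → ℝ) → ℂ) (s P : Fin (m + 1) → ℂ)
    (p : (ℝ × (Fin m → ℝ × ℝ)) × (ℝ × (Fin m → ℝ))) : ℂ :=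
  (((p.1.1 : ℂ) ^ (-(s 0 - ν)) * (Real.exp (-(1 / p.1.1)) : ℂ)) *
      ∏ j, liftPair ν s P j (p.1.2 j)) *
    ((((Real.pi * p.2.1 : ℝ) : ℂ) ^ (2 * (s 0 + ν)) * (Real.exp (-(Real.pi * p.2.1) ^ 2) : ℂ)) *
      (f p.2.2 * ∏ j, ((Real.pi * p.2.2 j : ℝ) : ℂ) ^ (2 * -P j.succ)))

/-- The product of the gamma functions that come from the Mellin inversion of exponentials. -/
noncomputable def inversionGamma {m : ℕ} (ν : ℂ) (s P : Fin (m + 1) → ℂ) : ℂ :=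
  (2 * (Real.pi : ℂ))⁻¹ ^ m * ∏ j : Fin m, Complex.Gamma (s j.succ + ν + P j.succ)

/-- The point `(0, τ + i x)`. -/
noncomputable def barnesPoint {m : ℕ} (τ x : Fin m → ℝ) : Fin (m + 1) → ℂ :=
  Fin.cons 0 (verticalPoint τ x)

theorem barnesPoint_succ {m : ℕ} (τ x : Fin m → ℝ) (j : Fin m) :
    barnesPoint τ x j.succ = (τ j : ℂ) + x j * Complex.I := rfl

theorem barnesPoint_zero {m : ℕ} (τ x : Fin m → ℝ) : barnesPoint τ x 0 = 0 := rfl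

theorem barnesPoint_re {m : ℕ} (τ x : Fin m → ℝ) (i : Fin (m + 1)) :
    (barnesPoint τ x i).re = (Fin.cons 0 τ : Fin (m + 1) → ℝ) i := by
  refine Fin.cases ?_ (fun j => ?_) i
  · simp [barnesPoint]
  · simp [barnesPoint_succ]

theorem measurable_barnesPoint {m : ℕ} (τ : Fin m → ℝ) (i : Fin (m + 1)) :
    Measurable fun x => barnesPoint τ x i := by
  refine Fin.cases ?_ (fun j => ?_) i
  · simp only [barnesPoint_zero]; fun_prop
  · simp only [barnesPoint_succ]; fun_prop

/-- Recombines the separated kernel into the form produced by Mellin inversion. The exponents of `π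
z_j` match because `2(s_{j+1} + ν) - 2(s_{j+1} + ν + P_{j+1}) = -2 P_{j+1}`. -/
theorem barnesKernel_eq {m : ℕ} (ν : ℂ) (f : (Fin m → ℝ) → ℂ) (s P : Fin (m + 1) → ℂ) (hP : P 0 = 0)
    {b : ℝ × (Fin m → ℝ × ℝ)} (ht : ∀ i, 0 < (unpair b).1 i) (hu : ∀ i, 0 < (unpair b).2 i)
    {z : ℝ × (Fin m → ℝ)} (hz : ∀ i, 0 < z.2 i) :
    barnesKernel ν f s P (b, z) =
      (((Real.pi * z.1 : ℝ) : ℂ) ^ (2 * (s 0 + ν)) * (Real.exp (-(Real.pi * z.1) ^ 2) : ℂ)) *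
      (liftCoeff (unpair b).1 (unpair b).2 0 : ℂ) ^ (-(s 0 + ν)) *
      (∏ j, (((Real.pi * z.2 j : ℝ) : ℂ) ^ (2 * (s j.succ + ν)) *
        (liftRatio (unpair b).1 (unpair b).2 j : ℂ) ^ (-(s j.succ + ν)) *
        (((Real.pi * z.2 j) ^ 2 * liftCoeff (unpair b).1 (unpair b).2 j.succ /
          liftRatio (unpair b).1 (unpair b).2 j : ℝ) : ℂ) ^ (-(s j.succ + ν + P j.succ)))) *
      liftWeight ν (unpair b).1 (unpair b).2 * f z.2 := by
  have h := liftWeight_mul_prod ν s P hP ht hu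
  have hb : ∀ j, ((unpair b).2 j, (unpair b).1 j.succ) = b.2 j := fun j => by simp [unpair]
  have hb0 : (unpair b).1 0 = b.1 := rfl
  simp only [hb, hb0] at h
  unfold barnesKernel
  simp only
  rw [← h, Fin.prod_univ_succ, hP, add_zero]
  have hj : ∀ j : Fin m, ((Real.pi * z.2 j : ℝ) : ℂ) ^ (2 * (s j.succ + ν)) *
        (liftRatio (unpair b).1 (unpair b).2 j : ℂ) ^ (-(s j.succ + ν)) *
        (((Real.pi * z.2 j) ^ 2 * liftCoeff (unpair b).1 (unpair b).2 j.succ /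
          liftRatio (unpair b).1 (unpair b).2 j : ℝ) : ℂ) ^ (-(s j.succ + ν + P j.succ)) =
      ((Real.pi * z.2 j : ℝ) : ℂ) ^ (2 * -P j.succ) *
      (liftCoeff (unpair b).1 (unpair b).2 j.succ : ℂ) ^ (-(s j.succ + ν + P j.succ)) *
      (liftRatio (unpair b).1 (unpair b).2 j : ℂ) ^ (P j.succ) := fun j => by
    have hy : 0 < Real.pi * z.2 j := mul_pos Real.pi_pos (hz j)
    have hc := liftCoeff_pos ht hu j.succ
    have hr := liftRatio_pos ht hu j
    rw [ofReal_cpow_div (by positivity) hr, ofReal_cpow_mul_mul (by positivity) hc,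
      ofReal_sq_cpow hy]
    have e1 : 2 * -P j.succ = 2 * (s j.succ + ν) + 2 * -(s j.succ + ν + P j.succ) := by ring
    have e2 : (liftRatio (unpair b).1 (unpair b).2 j : ℂ) ^ (P j.succ) =
        (liftRatio (unpair b).1 (unpair b).2 j : ℂ) ^ (-(s j.succ + ν)) *
        (liftRatio (unpair b).1 (unpair b).2 j : ℂ) ^ (- -(s j.succ + ν + P j.succ)) := by
      rw [← ofReal_cpow_add hr]; congr 1; ring
    rw [e1, ofReal_cpow_add hy, e2]
    ring
  rw [Finset.prod_congr rfl fun j _ => hj j]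
  simp only [Finset.prod_mul_distrib]
  ring

/-- After rescaling, every exponential except the one of index `0` is written by Mellin inversion
along the line through `s_{j+1} + ν + τ_j`; the product of these one-dimensional integrals is a
single integral over `x`. -/
theorem liftKernel_liftMap {m : ℕ} {ν : ℂ} (f : (Fin m → ℝ) → ℂ) {s : Fin (m + 1) → ℂ}
    {τ : Fin m → ℝ} (hs : ∀ j : Fin m, 0 < (s j.succ + ν + τ j).re)
    {b : ℝ × (Fin m → ℝ × ℝ)} (ht : ∀ i, 0 < (unpair b).1 i) (hu : ∀ i, 0 < (unpair b).2 i)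
    {z : ℝ × (Fin m → ℝ)} (hz0 : 0 < z.1) (hz : ∀ i, 0 < z.2 i) :
    liftKernel ν f (liftMap (b, z)).2 (liftMap (b, z)).1.1 (liftMap (b, z)).1.2 *
      ∏ i, ((Real.pi * (liftMap (b, z)).2 i : ℝ) : ℂ) ^ (2 * s i) =
    ∫ x : Fin m → ℝ, inversionGamma ν s (barnesPoint τ x) *
      barnesKernel ν f s (barnesPoint τ x) (b, z) := by
  set t := (unpair b).1 with htdef
  set u := (unpair b).2 with hudef
  have hR := liftRatio_pos ht hu
  have hC := liftCoeff_pos ht hu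
  have hcons : ∀ i, 0 < (Fin.cons z.1 z.2 : Fin (m + 1) → ℝ) i := fun i => by
    refine Fin.cases ?_ (fun j => ?_) i
    · simpa using hz0
    · simpa using hz j
  have hy : ∀ i, 0 < (liftMap (b, z)).2 i := fun i => mul_pos (hcons i) (liftScale_pos ht hu i)
  have hQ : ∀ j, 0 < (Real.pi * z.2 j) ^ 2 * liftCoeff t u j.succ / liftRatio t u j := fun j => by
    have := hz j; have := hR j; have := hC j.succ; have := Real.pi_pos
    positivity
  have hy0 : (liftMap (b, z)).2 0 = z.1 * (Real.sqrt (liftCoeff t u 0))⁻¹ := rfl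
  have hys : ∀ j : Fin m, (liftMap (b, z)).2 j.succ = z.2 j * (Real.sqrt (liftRatio t u j))⁻¹ :=
    fun j => rfl
  have hscale : ∀ {x r : ℝ}, 0 < x → 0 < r → ∀ w : ℂ,
      ((Real.pi * (x * (Real.sqrt r)⁻¹) : ℝ) : ℂ) ^ (2 * w) =
        ((Real.pi * x : ℝ) : ℂ) ^ (2 * w) * (r : ℂ) ^ (-w) := fun {x r} hx hr w => by
    have hsr : 0 < Real.sqrt r := Real.sqrt_pos.2 hr
    rw [← mul_assoc, ofReal_cpow_mul_mul (mul_pos Real.pi_pos hx) (inv_pos.2 hsr),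
      ofReal_cpow_inv hsr, ← mul_neg, ← ofReal_sq_cpow hsr, Real.sq_sqrt hr.le]
  have hf : (fun j : Fin m => (liftMap (b, z)).2 j.succ * Real.sqrt (liftRatio t u j)) = z.2 := by
    ext j
    rw [hys, inv_mul_cancel_right₀ (Real.sqrt_pos.2 (hR j)).ne']
  rw [liftKernel_mul_prod_cpow ν f s hy]
  change _ * liftWeight ν t u * f (fun j => _ * Real.sqrt (liftRatio t u j)) = _
  rw [hf, Fin.prod_univ_succ]
  change ((Real.exp (-((Real.pi * (liftMap (b, z)).2 0) ^ 2 * liftCoeff t u 0)) : ℂ) * _ *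
    ∏ j : Fin m, ((Real.exp (-((Real.pi * (liftMap (b, z)).2 j.succ) ^ 2 *
      liftCoeff t u j.succ)) : ℂ) * _)) * _ * _ = _
  have e0 : (Real.pi * (z.1 * (Real.sqrt (liftCoeff t u 0))⁻¹)) ^ 2 * liftCoeff t u 0 =
      (Real.pi * z.1) ^ 2 := by
    rw [mul_pow, mul_pow, inv_pow, Real.sq_sqrt (hC 0).le]
    have := (hC 0).ne'
    field_simp
  have ej : ∀ j, (Real.pi * (z.2 j * (Real.sqrt (liftRatio t u j))⁻¹)) ^ 2 *
      liftCoeff t u j.succ =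
      (Real.pi * z.2 j) ^ 2 * liftCoeff t u j.succ / liftRatio t u j := fun j => by
    rw [mul_pow, mul_pow, inv_pow, Real.sq_sqrt (hR j).le]
    ring
  simp only [hy0, hys, e0, ej, hscale hz0 (hC 0), hscale (hz _) (hR _)]
  have hexp : ∀ j : Fin m, (Real.exp (-((Real.pi * z.2 j) ^ 2 * liftCoeff t u j.succ /
      liftRatio t u j)) : ℂ) = (2 * (Real.pi : ℂ))⁻¹ * ∫ x : ℝ,
        Complex.Gamma (s j.succ + ν + τ j + x * Complex.I) *
        (((Real.pi * z.2 j) ^ 2 * liftCoeff t u j.succ / liftRatio t u j : ℝ) : ℂ) ^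
          (-(s j.succ + ν + τ j + x * Complex.I)) := fun j =>
    exp_neg_eq_integral_Gamma (hs j) (hQ j)
  rw [Finset.prod_mul_distrib, Finset.prod_congr rfl fun j _ => hexp j, Finset.prod_mul_distrib,
    Finset.prod_const, Finset.card_univ, Fintype.card_fin, ← integral_fintype_prod_volume_eq_prod]
  rw [← integral_const_mul, ← integral_mul_const, ← integral_const_mul, ← integral_mul_const,
    ← integral_mul_const]
  refine integral_congr_ae (ae_of_all _ fun x => ?_)
  simp only
  rw [barnesKernel_eq ν f s _ (barnesPoint_zero τ x) ht hu hz]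
  simp only [inversionGamma, barnesPoint_succ, Finset.prod_mul_distrib, add_assoc, ← htdef,
    ← hudef]
  ring

/-! ### Absolute convergence and Fubini -/

theorem norm_ofReal_cpow_congr {x : ℝ} (hx : 0 < x) {a b : ℂ} (hab : a.re = b.re) :
    ‖(x : ℂ) ^ a‖ = ‖(x : ℂ) ^ b‖ := by
  rw [Complex.norm_cpow_eq_rpow_re_of_pos hx, Complex.norm_cpow_eq_rpow_re_of_pos hx, hab]

theorem norm_liftPair_congr {m : ℕ} (ν : ℂ) (s : Fin (m + 1) → ℂ) {P P' : Fin (m + 1) → ℂ}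
    (hP : ∀ i, (P i).re = (P' i).re) (j : Fin m) {q : ℝ × ℝ} (h1 : 0 < q.1) (h2 : 0 < q.2) :
    ‖liftPair ν s P j q‖ = ‖liftPair ν s P' j q‖ := by
  have h3 : 0 < 1 + q.1 / q.2 := by positivity
  simp only [liftPair, pairKernel, norm_mul]
  rw [norm_ofReal_cpow_congr h1 (b := ν + P' j.castSucc - P' j.succ) (by simp [hP]),
    norm_ofReal_cpow_congr h2 (b := -(s j.succ + P' j.castSucc)) (by simp [hP]),
    norm_ofReal_cpow_congr h3 (b := -(s j.castSucc + ν + P' j.castSucc)) (by simp [hP])]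

/-- `P` occurs only in exponents of positive bases, so its imaginary part does not affect the
modulus. -/
theorem norm_barnesKernel_congr {m : ℕ} (ν : ℂ) (f : (Fin m → ℝ) → ℂ) (s : Fin (m + 1) → ℂ)
    {P P' : Fin (m + 1) → ℂ} (hP : ∀ i, (P i).re = (P' i).re)
    {b : ℝ × (Fin m → ℝ × ℝ)} (ht : ∀ i, 0 < (unpair b).1 i) (hu : ∀ i, 0 < (unpair b).2 i)
    {z : ℝ × (Fin m → ℝ)} (hz : ∀ i, 0 < z.2 i) :
    ‖barnesKernel ν f s P (b, z)‖ = ‖barnesKernel ν f s P' (b, z)‖ := by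
  have h1 : ∀ j, ‖liftPair ν s P j (b.2 j)‖ = ‖liftPair ν s P' j (b.2 j)‖ := fun j =>
    norm_liftPair_congr ν s hP j (hu j) (ht j.succ)
  have h2 : ∀ j : Fin m, ‖((Real.pi * z.2 j : ℝ) : ℂ) ^ (2 * -P j.succ)‖ =
      ‖((Real.pi * z.2 j : ℝ) : ℂ) ^ (2 * -P' j.succ)‖ := fun j =>
    norm_ofReal_cpow_congr (mul_pos Real.pi_pos (hz j)) (by simp [hP])
  simp only [barnesKernel, norm_mul, norm_prod, h1, h2]

/-- The inequalities describing the region of absolute convergence of the Mellin–Barnes formula. -/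
structure LiftRegion {m : ℕ} (ν : ℂ) (s : Fin (m + 1) → ℂ) (τ : Fin m → ℝ) : Prop where
  add_lt : ∀ j, -(Fin.cons 0 τ : Fin (m + 1) → ℝ) j + ν.re < (s j).re
  sub_lt : ∀ j, -(Fin.cons 0 τ : Fin (m + 1) → ℝ) j - ν.re < (s j).re
  left : ∀ j : Fin m, -τ j < (s j.castSucc).re
  right : ∀ j : Fin m, -(Fin.cons 0 τ : Fin (m + 1) → ℝ) j.castSucc < (s j.succ).re

section

variable {m : ℕ} {ν : ℂ} {s : Fin (m + 1) → ℂ} {τ : Fin m → ℝ}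

/-- The three gamma arguments of the pair integral have positive real part by `left`, `right` and
`add_lt` respectively. -/
theorem LiftRegion.integrable_liftPair (h : LiftRegion ν s τ) (x : Fin m → ℝ) (j : Fin m) :
    Integrable (liftPair ν s (barnesPoint τ x) j) (mulHaar.prod mulHaar) := by
  have h1 := h.add_lt j.succ
  have h2 := h.left j
  have h3 := h.right j
  rw [Fin.cons_succ] at h1
  refine integrable_pairKernel (α := s j.castSucc + barnesPoint τ x j.succ)
    (β := s j.succ + barnesPoint τ x j.castSucc)
    (γ := s j.succ + barnesPoint τ x j.succ - ν) ?_ ?_ ?_ rfl (by ring) (by ring)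
  · rw [Complex.add_re, barnesPoint_re, Fin.cons_succ]; linarith
  · rw [Complex.add_re, barnesPoint_re]; linarith
  · rw [Complex.sub_re, Complex.add_re, barnesPoint_re, Fin.cons_succ]; linarith

theorem LiftRegion.integral_liftPair (h : LiftRegion ν s τ) (x : Fin m → ℝ) (j : Fin m) :
    ∫ q, liftPair ν s (barnesPoint τ x) j q ∂mulHaar.prod mulHaar =
      Complex.Gamma (s j.castSucc + barnesPoint τ x j.succ) *
        Complex.Gamma (s j.succ + barnesPoint τ x j.castSucc) /
        Complex.Gamma (s j.castSucc + barnesPoint τ x j.succ +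
          (s j.succ + barnesPoint τ x j.castSucc)) *
        Complex.Gamma (s j.succ + barnesPoint τ x j.succ - ν) := by
  have h1 := h.add_lt j.succ
  have h2 := h.left j
  have h3 := h.right j
  rw [Fin.cons_succ] at h1
  refine integral_pairKernel ?_ ?_ ?_ rfl (by ring) (by ring)
  · rw [Complex.add_re, barnesPoint_re, Fin.cons_succ]; linarith
  · rw [Complex.add_re, barnesPoint_re]; linarith
  · rw [Complex.sub_re, Complex.add_re, barnesPoint_re, Fin.cons_succ]; linarith

theorem LiftRegion.zero_add_pos (h : LiftRegion ν s τ) : 0 < (s 0 + ν).re := by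
  have := h.sub_lt 0
  rw [Fin.cons_zero] at this
  rw [Complex.add_re]; linarith

theorem LiftRegion.zero_sub_pos (h : LiftRegion ν s τ) : 0 < (s 0 - ν).re := by
  have := h.add_lt 0
  rw [Fin.cons_zero] at this
  rw [Complex.sub_re]; linarith

theorem LiftRegion.succ_add_pos (h : LiftRegion ν s τ) (j : Fin m) :
    0 < (s j.succ + ν + τ j).re := by
  have := h.sub_lt j.succ
  rw [Fin.cons_succ] at this
  simp only [Complex.add_re, Complex.ofReal_re]; linarith

theorem LiftRegion.integrable_inversionGamma (h : LiftRegion ν s τ) :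
    Integrable fun x => inversionGamma ν s (barnesPoint τ x) := by
  unfold inversionGamma
  refine Integrable.const_mul ?_ _
  simp only [barnesPoint_succ, ← add_assoc]
  exact Integrable.fintype_prod (𝕜 := ℂ)
    (f := fun j (x : ℝ) => Complex.Gamma (s (Fin.succ j) + ν + τ j + x * Complex.I))
    fun j => integrable_Gamma_vertical (h.succ_add_pos j)

theorem LiftRegion.integrable_barnesKernel (h : LiftRegion ν s τ) {f : (Fin m → ℝ) → ℂ}
    (x : Fin m → ℝ) (hf : Integrable (fun y => f y * ∏ j : Fin m, ((Real.pi * y j : ℝ) : ℂ) ^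
      (2 * -barnesPoint τ x j.succ)) (mulHaarPi m)) :
    Integrable (barnesKernel ν f s (barnesPoint τ x))
      ((pairMeasure m).prod (mulHaar.prod (mulHaarPi m))) := by
  unfold barnesKernel pairMeasure
  refine Integrable.mul_prod
    (f := fun b : ℝ × (Fin m → ℝ × ℝ) => ((b.1 : ℂ) ^ (-(s 0 - ν)) * (Real.exp (-(1 / b.1)) : ℂ)) *
      ∏ j, liftPair ν s (barnesPoint τ x) j (b.2 j))
    (g := fun z : ℝ × (Fin m → ℝ) => (((Real.pi * z.1 : ℝ) : ℂ) ^ (2 * (s 0 + ν)) *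
      (Real.exp (-(Real.pi * z.1) ^ 2) : ℂ)) *
      (f z.2 * ∏ j : Fin m, ((Real.pi * z.2 j : ℝ) : ℂ) ^ (2 * -barnesPoint τ x j.succ))) ?_ ?_
  · exact Integrable.mul_prod (integrable_cpow_neg_mul_exp_neg_inv h.zero_sub_pos)
      (Integrable.fintype_prod (𝕜 := ℂ) fun j => h.integrable_liftPair x j)
  · exact Integrable.mul_prod (integrable_cpow_mul_exp_neg_sq h.zero_add_pos) hf

theorem LiftRegion.integral_barnesKernel (h : LiftRegion ν s τ) (f : (Fin m → ℝ) → ℂ)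
    (x : Fin m → ℝ) :
    ∫ p, barnesKernel ν f s (barnesPoint τ x) p
        ∂(pairMeasure m).prod (mulHaar.prod (mulHaarPi m)) =
      (Complex.Gamma (s 0 - ν) * ∏ j : Fin m,
        (Complex.Gamma (s j.castSucc + barnesPoint τ x j.succ) *
        Complex.Gamma (s j.succ + barnesPoint τ x j.castSucc) /
        Complex.Gamma (s j.castSucc + barnesPoint τ x j.succ +
          (s j.succ + barnesPoint τ x j.castSucc)) *
        Complex.Gamma (s j.succ + barnesPoint τ x j.succ - ν))) *
      (2⁻¹ * Complex.Gamma (s 0 + ν) *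
        ∫ y, f y * ∏ j : Fin m, ((Real.pi * y j : ℝ) : ℂ) ^ (2 * -barnesPoint τ x j.succ)
          ∂mulHaarPi m) := by
  unfold barnesKernel pairMeasure
  rw [integral_prod_mul
    (fun b : ℝ × (Fin m → ℝ × ℝ) => ((b.1 : ℂ) ^ (-(s 0 - ν)) * (Real.exp (-(1 / b.1)) : ℂ)) *
      ∏ j, liftPair ν s (barnesPoint τ x) j (b.2 j))
    (fun z : ℝ × (Fin m → ℝ) => (((Real.pi * z.1 : ℝ) : ℂ) ^ (2 * (s 0 + ν)) *
      (Real.exp (-(Real.pi * z.1) ^ 2) : ℂ)) *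
      (f z.2 * ∏ j : Fin m, ((Real.pi * z.2 j : ℝ) : ℂ) ^ (2 * -barnesPoint τ x j.succ))),
    integral_prod_mul (fun t : ℝ => (t : ℂ) ^ (-(s 0 - ν)) * (Real.exp (-(1 / t)) : ℂ))
      (fun b : Fin m → ℝ × ℝ => ∏ j, liftPair ν s (barnesPoint τ x) j (b j)),
    integral_prod_mul (fun y : ℝ => ((Real.pi * y : ℝ) : ℂ) ^ (2 * (s 0 + ν)) *
      (Real.exp (-(Real.pi * y) ^ 2) : ℂ))
      (fun y : Fin m → ℝ => f y * ∏ j : Fin m, ((Real.pi * y j : ℝ) : ℂ) ^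
        (2 * -barnesPoint τ x j.succ)),
    integral_fintype_prod_eq_prod, integral_cpow_neg_mul_exp_neg_inv h.zero_sub_pos,
    integral_cpow_mul_exp_neg_sq h.zero_add_pos,
    Finset.prod_congr rfl fun j _ => h.integral_liftPair x j]

theorem measurable_barnesKernel (ν : ℂ) (s : Fin (m + 1) → ℂ) (τ : Fin m → ℝ)
    {f : (Fin m → ℝ) → ℂ} (hf : Measurable f) :
    Measurable fun q : (Fin m → ℝ) × ((ℝ × (Fin m → ℝ × ℝ)) × (ℝ × (Fin m → ℝ))) =>
      barnesKernel ν f s (barnesPoint τ q.1) q.2 := by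
  have h : ∀ i, Measurable fun q : (Fin m → ℝ) × ((ℝ × (Fin m → ℝ × ℝ)) × (ℝ × (Fin m → ℝ))) =>
      barnesPoint τ q.1 i := fun i => (measurable_barnesPoint τ i).comp measurable_fst
  unfold barnesKernel liftPair pairKernel
  fun_prop

/-- The integrand has the same modulus as the product of `inversionGamma`, a function of `x` alone,
and the kernel frozen at `x = 0`; both factors are integrable. -/
theorem LiftRegion.integrable_uncurry (h : LiftRegion ν s τ) {f : (Fin m → ℝ) → ℂ}
    (hfm : Measurable f) (hf : Integrable (fun y => f y * ∏ j : Fin m, ((Real.pi * y j : ℝ) : ℂ) ^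
      (2 * -(τ j : ℂ))) (mulHaarPi m)) :
    Integrable (fun q : (Fin m → ℝ) × ((ℝ × (Fin m → ℝ × ℝ)) × (ℝ × (Fin m → ℝ))) =>
      inversionGamma ν s (barnesPoint τ q.1) * barnesKernel ν f s (barnesPoint τ q.1) q.2)
      (volume.prod ((pairMeasure m).prod (mulHaar.prod (mulHaarPi m)))) := by
  have h0 : Integrable (barnesKernel ν f s (barnesPoint τ 0))
      ((pairMeasure m).prod (mulHaar.prod (mulHaarPi m))) :=
    h.integrable_barnesKernel 0 (by simpa [barnesPoint_succ] using hf)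
  refine (h.integrable_inversionGamma.mul_prod h0).congr' ?_ ?_
  · exact (h.integrable_inversionGamma.aestronglyMeasurable.comp_quasiMeasurePreserving
      Measure.quasiMeasurePreserving_fst).mul
      (measurable_barnesKernel ν s τ hfm).aestronglyMeasurable
  · have hb := (Measure.quasiMeasurePreserving_fst (ν := mulHaar.prod (mulHaarPi m))).ae
      (ae_pairMeasure_pos m)
    have hz : ∀ᵐ p ∂(pairMeasure m).prod (mulHaar.prod (mulHaarPi m)), ∀ i, 0 < p.2.2 i :=
      Measure.quasiMeasurePreserving_snd.ae
        (Measure.quasiMeasurePreserving_snd.ae (ae_mulHaarPi_pos m))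
    filter_upwards [(Measure.quasiMeasurePreserving_snd
      (μ := (volume : Measure (Fin m → ℝ)))).ae (hb.and hz)] with q hq
    rw [norm_mul, norm_mul]
    congr 1
    exact norm_barnesKernel_congr ν f s (fun i => by rw [barnesPoint_re, barnesPoint_re])
      hq.1.1 hq.1.2 hq.2

/-- The gamma factors of the Mellin–Barnes integrand. -/
noncomputable def barnesGamma (ν : ℂ) (s P : Fin (m + 1) → ℂ) : ℂ :=
  (∏ i, Complex.Gamma (s i + P i + ν) * Complex.Gamma (s i + P i - ν)) *
    ∏ j : Fin m, Complex.Gamma (s j.castSucc + P j.succ) *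
      Complex.Gamma (s j.succ + P j.castSucc) /
      Complex.Gamma (s j.castSucc + s j.succ + P j.castSucc + P j.succ)

theorem LiftRegion.integral_inversionGamma_mul (h : LiftRegion ν s τ) (f : (Fin m → ℝ) → ℂ)
    (x : Fin m → ℝ) :
    ∫ p, inversionGamma ν s (barnesPoint τ x) * barnesKernel ν f s (barnesPoint τ x) p
        ∂(pairMeasure m).prod (mulHaar.prod (mulHaarPi m)) =
      2⁻¹ * (2 * (Real.pi : ℂ))⁻¹ ^ m * (barnesGamma ν s (barnesPoint τ x) *
        ∫ y, f y * ∏ j : Fin m, ((Real.pi * y j : ℝ) : ℂ) ^ (2 * -barnesPoint τ x j.succ)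
          ∂mulHaarPi m) := by
  rw [integral_const_mul, h.integral_barnesKernel]
  unfold inversionGamma barnesGamma
  rw [Fin.prod_univ_succ, barnesPoint_zero, add_zero]
  have e1 : ∀ j : Fin m, s j.castSucc + barnesPoint τ x j.succ +
      (s j.succ + barnesPoint τ x j.castSucc) =
      s j.castSucc + s j.succ + barnesPoint τ x j.castSucc + barnesPoint τ x j.succ :=
    fun j => by ring
  have e2 : ∀ j : Fin m, s j.succ + ν + barnesPoint τ x j.succ =
      s j.succ + barnesPoint τ x j.succ + ν := fun j => by ring
  simp only [e1, e2]
  rw [Finset.prod_mul_distrib, Finset.prod_mul_distrib]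
  ring

theorem LiftRegion.integrable_barnesGamma_mul (h : LiftRegion ν s τ) {f : (Fin m → ℝ) → ℂ}
    (hfm : Measurable f) (hf : Integrable (fun y => f y * ∏ j : Fin m, ((Real.pi * y j : ℝ) : ℂ) ^
      (2 * -(τ j : ℂ))) (mulHaarPi m)) :
    Integrable fun x : Fin m → ℝ => barnesGamma ν s (barnesPoint τ x) *
        ∫ y, f y * ∏ j : Fin m, ((Real.pi * y j : ℝ) : ℂ) ^ (2 * -barnesPoint τ x j.succ)
          ∂mulHaarPi m := by
  have h1 := (h.integrable_uncurry hfm hf).integral_prod_left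
  simp only [h.integral_inversionGamma_mul] at h1
  have hc : (2⁻¹ * (2 * (Real.pi : ℂ))⁻¹ ^ m) ≠ 0 := by
    simp [Real.pi_ne_zero]
  exact (integrable_const_mul_iff (IsUnit.mk0 _ hc) _).1 h1

/-- Joint integrability over `x` and the separated variables gives everything: integrating out `x`
makes the lift integrand integrable in `(t, u, y)`, and the opposite order of integration gives the
Barnes integral. -/
theorem LiftRegion.integrable_and_integral_eq (h : LiftRegion ν s τ) {f : (Fin m → ℝ) → ℂ}
    (hfm : Measurable f) (hf : Integrable (fun y => f y * ∏ j : Fin m, ((Real.pi * y j : ℝ) : ℂ) ^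
      (2 * -(τ j : ℂ))) (mulHaarPi m)) :
    Integrable (fun y => whittakerLift ν f y * ∏ i, ((Real.pi * y i : ℝ) : ℂ) ^ (2 * s i))
      (mulHaarPi (m + 1)) ∧
    ∫ y, whittakerLift ν f y * ∏ i, ((Real.pi * y i : ℝ) : ℂ) ^ (2 * s i) ∂mulHaarPi (m + 1) =
      2⁻¹ * (2 * (Real.pi : ℂ))⁻¹ ^ m * ∫ x : Fin m → ℝ, barnesGamma ν s (barnesPoint τ x) *
        ∫ y, f y * ∏ j : Fin m, ((Real.pi * y j : ℝ) : ℂ) ^ (2 * -barnesPoint τ x j.succ)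
          ∂mulHaarPi m := by
  set H : ((Fin (m + 1) → ℝ) × (Fin m → ℝ)) × (Fin (m + 1) → ℝ) → ℂ := fun p =>
    liftKernel ν f p.2 p.1.1 p.1.2 * ∏ i, ((Real.pi * p.2 i : ℝ) : ℂ) ^ (2 * s i) with hH
  have hHm : Measurable H := (measurable_liftKernel ν hfm).mul (by fun_prop)
  have hJ := h.integrable_uncurry hfm hf
  have hHJ : (fun p => H (liftMap p)) =ᵐ[(pairMeasure m).prod (mulHaar.prod (mulHaarPi m))]
      fun p => ∫ x : Fin m → ℝ, inversionGamma ν s (barnesPoint τ x) *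
        barnesKernel ν f s (barnesPoint τ x) p := by
    have hb := (Measure.quasiMeasurePreserving_fst (ν := mulHaar.prod (mulHaarPi m))).ae
      (ae_pairMeasure_pos m)
    have hz : ∀ᵐ p ∂(pairMeasure m).prod (mulHaar.prod (mulHaarPi m)), ∀ i, 0 < p.2.2 i :=
      Measure.quasiMeasurePreserving_snd.ae
        (Measure.quasiMeasurePreserving_snd.ae (ae_mulHaarPi_pos m))
    have hz0 : ∀ᵐ p ∂(pairMeasure m).prod (mulHaar.prod (mulHaarPi m)), 0 < p.2.1 :=
      Measure.quasiMeasurePreserving_snd.ae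
        (Measure.quasiMeasurePreserving_fst.ae ae_mulHaar_pos)
    filter_upwards [hb, hz, hz0] with p h1 h2 h3
    exact liftKernel_liftMap f h.succ_add_pos h1.1 h1.2 h3 h2
  have hHint : Integrable H
      (((mulHaarPi (m + 1)).prod (mulHaarPi m)).prod (mulHaarPi (m + 1))) := by
    rw [← (measurePreserving_liftMap m).integrable_comp hHm.aestronglyMeasurable]
    exact hJ.integral_prod_right.congr hHJ.symm
  have hval : ∫ p, H p ∂((mulHaarPi (m + 1)).prod (mulHaarPi m)).prod (mulHaarPi (m + 1)) =
      2⁻¹ * (2 * (Real.pi : ℂ))⁻¹ ^ m * ∫ x : Fin m → ℝ, barnesGamma ν s (barnesPoint τ x) *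
        ∫ y, f y * ∏ j : Fin m, ((Real.pi * y j : ℝ) : ℂ) ^ (2 * -barnesPoint τ x j.succ)
          ∂mulHaarPi m := by
    rw [← (measurePreserving_liftMap m).map_eq,
      integral_map (measurePreserving_liftMap m).aemeasurable hHm.aestronglyMeasurable,
      integral_congr_ae hHJ, ← integral_integral_swap hJ, ← integral_const_mul]
    simp only [h.integral_inversionGamma_mul]
  have hlift : (fun y => ∫ q, H (q, y) ∂(mulHaarPi (m + 1)).prod (mulHaarPi m))
      =ᵐ[mulHaarPi (m + 1)]
      fun y => whittakerLift ν f y * ∏ i, ((Real.pi * y i : ℝ) : ℂ) ^ (2 * s i) := by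
    -- The iterated integral in the recursion agrees with the double integral only where the slice
    -- is integrable, hence for almost every `y`.
    filter_upwards [hHint.prod_left_ae] with y hy
    rw [integral_prod _ hy]
    simp only [hH, integral_mul_const]
    rfl
  refine ⟨hHint.integral_prod_right.congr hlift, ?_⟩
  rw [← integral_congr_ae hlift, ← hval, integral_prod_symm _ hHint]

end

/-! ### Rank one, absolute convergence, and the main theorem -/

theorem mellinIntegrand_eq (n : ℕ) (ν s : Fin n → ℂ) :
    mellinIntegrand n ν s = fun y =>
      (whittaker n ν y * ∏ i, ((Real.pi * y i : ℝ) : ℂ) ^ (2 * s i)) * ∏ i, ((y i : ℂ))⁻¹ := by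
  ext y
  rw [mellinIntegrand, Finset.prod_mul_distrib, mul_assoc]

theorem whittakerMellinConvergent_iff (n : ℕ) (ν s : Fin n → ℂ) :
    WhittakerMellinConvergent n ν s ↔
      Integrable (fun y => whittaker n ν y * ∏ i, ((Real.pi * y i : ℝ) : ℂ) ^ (2 * s i))
        (mulHaarPi n) := by
  rw [WhittakerMellinConvergent, mellinIntegrand_eq]
  exact integrableOn_posOrthant_mul_prod_inv _

theorem whittakerMellin_eq (n : ℕ) (ν s : Fin n → ℂ) :
    whittakerMellin n ν s =
      ∫ y, whittaker n ν y * ∏ i, ((Real.pi * y i : ℝ) : ℂ) ^ (2 * s i) ∂mulHaarPi n := by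
  rw [whittakerMellin, mellinIntegrand_eq]
  exact integral_posOrthant_mul_prod_inv _

theorem measurable_besselK (μ : ℂ) : Measurable (besselK μ) := by
  unfold besselK
  refine Measurable.const_mul ?_ _
  have h : Measurable fun p : ℝ × ℝ =>
      (Real.exp (-(p.1 / 2) * (p.2 + 1 / p.2)) : ℂ) * (p.2 : ℂ) ^ μ / (p.2 : ℂ) := by fun_prop
  exact (StronglyMeasurable.integral_prod_right' h.stronglyMeasurable).measurable

theorem measurable_whittaker : ∀ (n : ℕ) (ν : Fin n → ℂ), Measurable (whittaker n ν)
  | 0, ν => by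
    have : whittaker 0 ν = fun _ => 1 := by ext; rw [whittaker]
    rw [this]; exact measurable_const
  | 1, ν => by
    have : whittaker 1 ν = fun y => 2 * besselK (2 * ν 0) (2 * Real.pi * y 0) := by
      ext; rw [whittaker]
    rw [this]
    have := measurable_besselK (2 * ν 0)
    fun_prop
  | n + 2, ν => by
    rw [whittaker_add_two]
    exact measurable_whittakerLift _ (measurable_whittaker (n + 1) _)

theorem besselK_eq_integral_mulHaar (μ : ℂ) (z : ℝ) :
    2 * besselK μ z = ∫ t : ℝ, (t : ℂ) ^ μ * (Real.exp (-(z / 2) * (t + 1 / t)) : ℂ) ∂mulHaar := by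
  rw [integral_mulHaar_cpow_mul (fun t => (Real.exp (-(z / 2) * (t + 1 / t)) : ℂ)), besselK, mellin,
    mul_inv_cancel_left₀ two_ne_zero]
  refine setIntegral_congr_fun measurableSet_Ioi fun t (ht : 0 < t) => ?_
  simp only [smul_eq_mul]
  rw [Complex.cpow_sub _ _ (by exact_mod_cast ht.ne'), Complex.cpow_one]
  ring

theorem integral_mulHaarPi_one (g : (Fin 1 → ℝ) → ℂ) :
    ∫ t, g t ∂mulHaarPi 1 = ∫ t, g (fun _ => t) ∂mulHaar :=
  ((measurePreserving_funUnique mulHaar (Fin 1)).symm.integral_comp' g).symm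

/-- The substitution `t ↦ t/(π y_0)` in the Bessel integral gives the rank raising formula with an
empty set of `u`. Rank one thereby becomes an instance of the general theorem. -/
theorem whittaker_one (ν : Fin 1 → ℂ) {y : Fin 1 → ℝ} (hy : 0 < y 0) :
    whittaker 1 ν y = whittakerLift (m := 0) (ν 0) (fun _ => 1) y := by
  have hπ : 0 < Real.pi * y 0 := mul_pos Real.pi_pos hy
  have h0 : mulHaarPi 0 = Measure.dirac isEmptyElim := Measure.pi_of_empty _
  rw [whittaker, besselK_eq_integral_mulHaar, whittakerLift]
  simp only [h0, integral_dirac]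
  refine Eq.trans ?_ (integral_mulHaarPi_one _).symm
  conv_rhs => rw [← (measurePreserving_mul_mulHaar (inv_pos.2 hπ)).map_eq]
  rw [integral_map (by fun_prop)
    (Measurable.aestronglyMeasurable (by unfold liftKernel; fun_prop))]
  refine integral_congr_ae ?_
  filter_upwards [ae_mulHaar_pos] with t ht
  simp only [liftKernel, Fin.prod_univ_succ, Finset.univ_eq_empty, Finset.prod_empty, mul_one]
  rw [ofReal_cpow_mul_mul ht (inv_pos.2 hπ), ofReal_cpow_inv hπ]
  have h1 : ((Real.pi * y 0 : ℝ) : ℂ) ^ (2 * ν 0) * ((Real.pi * y 0 : ℝ) : ℂ) ^ (-(2 * ν 0)) = 1 := by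
    rw [← ofReal_cpow_add hπ, add_neg_cancel, Complex.cpow_zero]
  have h2 : -(2 * Real.pi * y 0 / 2) * (t + 1 / t) =
      -(Real.pi * y 0) ^ 2 * (t * (Real.pi * y 0)⁻¹) - 1 / (t * (Real.pi * y 0)⁻¹) := by
    field_simp
    ring
  rw [h2]
  linear_combination -(t : ℂ) ^ (2 * ν 0) * (Real.exp (-(Real.pi * y 0) ^ 2 *
    (t * (Real.pi * y 0)⁻¹) - 1 / (t * (Real.pi * y 0)⁻¹)) : ℂ) * h1

/-- The case `m = 0` of the lift theorem: measures on the one-point space `Fin 0 → ℝ` are Dirac, and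
only the two gamma factors of index `0` survive. -/
theorem whittaker_one_mellin (ν s : Fin 1 → ℂ) (h : |(ν 0).re| < (s 0).re) :
    WhittakerMellinConvergent 1 ν s ∧
      whittakerMellin 1 ν s = 2⁻¹ * Complex.Gamma (s 0 + ν 0) * Complex.Gamma (s 0 - ν 0) := by
  obtain ⟨h1, h2⟩ := abs_lt.1 h
  have hreg : LiftRegion (m := 0) (ν 0) s isEmptyElim := by
    refine ⟨fun j => ?_, fun j => ?_, isEmptyElim, isEmptyElim⟩ <;>
    · rw [Fin.fin_one_eq_zero j, Fin.cons_zero]; linarith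
  have h0 : mulHaarPi 0 = Measure.dirac isEmptyElim := Measure.pi_of_empty _
  obtain ⟨hint, hval⟩ := hreg.integrable_and_integral_eq (f := fun _ => 1) measurable_const
    (by rw [h0]; exact integrable_dirac (by simp))
  have hae : (fun y => whittakerLift (m := 0) (ν 0) (fun _ => 1) y *
      ∏ i, ((Real.pi * y i : ℝ) : ℂ) ^ (2 * s i)) =ᵐ[mulHaarPi 1]
      fun y => whittaker 1 ν y * ∏ i, ((Real.pi * y i : ℝ) : ℂ) ^ (2 * s i) := by
    filter_upwards [ae_mulHaarPi_pos 1] with y hy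
    rw [whittaker_one ν (hy 0)]
  rw [whittakerMellinConvergent_iff, whittakerMellin_eq, ← integral_congr_ae hae, hval]
  refine ⟨hint.congr hae, ?_⟩
  have hv : (volume : Measure (Fin 0 → ℝ)) = Measure.dirac isEmptyElim :=
    volume_pi.trans (Measure.pi_of_empty _)
  simp [h0, hv, barnesGamma, barnesPoint_zero]
  ring

theorem whittakerMellinConvergent_congr_re {n : ℕ} {ν s s' : Fin n → ℂ}
    (hs : ∀ i, (s i).re = (s' i).re) (h : WhittakerMellinConvergent n ν s) :
    WhittakerMellinConvergent n ν s' := by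
  rw [whittakerMellinConvergent_iff] at h ⊢
  refine h.congr' ?_ ?_
  · have := measurable_whittaker n ν
    exact Measurable.aestronglyMeasurable (by fun_prop)
  · filter_upwards [ae_mulHaarPi_pos n] with y hy
    simp only [norm_mul, norm_prod]
    congr 1
    exact Finset.prod_congr rfl fun i _ =>
      norm_ofReal_cpow_congr (mul_pos Real.pi_pos (hy i)) (by simp [hs])

theorem LiftRegion.whittaker_mellin {n : ℕ} {ν s : Fin (n + 2) → ℂ} {τ : Fin (n + 1) → ℝ}
    (h : LiftRegion (ν (Fin.last (n + 1))) s τ)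
    (hT : WhittakerMellinConvergent (n + 1) (fun i => ν i.castSucc) fun i => -(τ i : ℂ)) :
    WhittakerMellinConvergent (n + 2) ν s ∧
      VerticalIntegrable τ (barnesIntegrand n ν s) ∧
      whittakerMellin (n + 2) ν s = 2⁻¹ / (2 * (Real.pi : ℂ) * Complex.I) ^ (n + 1) *
        verticalIntegral τ (barnesIntegrand n ν s) := by
  have hm := measurable_whittaker (n + 1) fun i => ν i.castSucc
  have hf := (whittakerMellinConvergent_iff _ _ _).1 hT
  obtain ⟨hint, hval⟩ := h.integrable_and_integral_eq hm hf
  have hB : ∀ x : Fin (n + 1) → ℝ, barnesIntegrand n ν s (verticalPoint τ x) =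
      barnesGamma (ν (Fin.last (n + 1))) s (barnesPoint τ x) *
        ∫ y, whittaker (n + 1) (fun i => ν i.castSucc) y * ∏ j : Fin (n + 1),
          ((Real.pi * y j : ℝ) : ℂ) ^ (2 * -barnesPoint τ x j.succ) ∂mulHaarPi (n + 1) := by
    intro x
    rw [barnesIntegrand, whittakerMellin_eq]
    rfl
  rw [whittakerMellinConvergent_iff, whittakerMellin_eq, whittaker_add_two, hval,
    VerticalIntegrable, verticalIntegral]
  simp only [hB]
  refine ⟨hint, h.integrable_barnesGamma_mul hm hf, ?_⟩
  -- The powers of `i` from `dt_j = i dx_j` cancel those in the prefactor.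
  have hI : Complex.I ^ (n + 1) ≠ 0 := pow_ne_zero _ Complex.I_ne_zero
  rw [mul_pow, ← mul_assoc, div_mul_eq_mul_div, mul_div_mul_right _ _ hI, inv_pow, div_eq_mul_inv]

/-! ### The region of convergence in every rank -/

/-- The least upper bound of the sums of `k` of the numbers `|Re ν_i|`. -/
noncomputable def topSum {n : ℕ} (ν : Fin n → ℂ) (k : ℕ) : ℝ :=
  ⨆ S : {S : Finset (Fin n) // S.card ≤ k}, ∑ i ∈ S.1, |(ν i).re|

theorem le_topSum {n : ℕ} (ν : Fin n → ℂ) {k : ℕ} {S : Finset (Fin n)} (hS : S.card ≤ k) :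
    ∑ i ∈ S, |(ν i).re| ≤ topSum ν k :=
  le_ciSup (f := fun S : {S : Finset (Fin n) // S.card ≤ k} => ∑ i ∈ S.1, |(ν i).re|)
    (Set.finite_range _).bddAbove ⟨S, hS⟩

theorem topSum_nonneg {n : ℕ} (ν : Fin n → ℂ) (k : ℕ) : 0 ≤ topSum ν k := by
  simpa using le_topSum ν (S := ∅) (k := k) (by simp)

theorem topSum_le {n : ℕ} (ν : Fin n → ℂ) {k : ℕ} {a : ℝ}
    (h : ∀ S : Finset (Fin n), S.card ≤ k → ∑ i ∈ S, |(ν i).re| ≤ a) : topSum ν k ≤ a := by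
  have : Nonempty {S : Finset (Fin n) // S.card ≤ k} := ⟨⟨∅, by simp⟩⟩
  exact ciSup_le fun S => h S.1 S.2

theorem exists_topSum {n : ℕ} (ν : Fin n → ℂ) (k : ℕ) :
    ∃ S : Finset (Fin n), S.card ≤ k ∧ ∑ i ∈ S, |(ν i).re| = topSum ν k := by
  have : Nonempty {S : Finset (Fin n) // S.card ≤ k} := ⟨⟨∅, by simp⟩⟩
  obtain ⟨S, hS⟩ := exists_eq_ciSup_of_finite
    (f := fun S : {S : Finset (Fin n) // S.card ≤ k} => ∑ i ∈ S.1, |(ν i).re|)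
  exact ⟨S.1, S.2, hS⟩

theorem topSum_mono {n : ℕ} (ν : Fin n → ℂ) {k l : ℕ} (h : k ≤ l) : topSum ν k ≤ topSum ν l :=
  topSum_le ν fun _ hS => le_topSum ν (hS.trans h)

theorem topSum_castSucc_le {n : ℕ} (ν : Fin (n + 1) → ℂ) (k : ℕ) :
    topSum (fun i : Fin n => ν i.castSucc) k ≤ topSum ν k := by
  refine topSum_le _ fun S hS => ?_
  have := le_topSum ν (S := S.map Fin.castSuccEmb) (k := k) (by simpa using hS)
  simpa using this

theorem topSum_castSucc_add_le {n : ℕ} (ν : Fin (n + 1) → ℂ) (k : ℕ) :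
    topSum (fun i : Fin n => ν i.castSucc) k + |(ν (Fin.last n)).re| ≤ topSum ν (k + 1) := by
  rw [← le_sub_iff_add_le]
  refine topSum_le _ fun S hS => ?_
  have hmem : Fin.last n ∉ S.map Fin.castSuccEmb := by simp [Fin.castSucc_ne_last]
  have := le_topSum ν (S := insert (Fin.last n) (S.map Fin.castSuccEmb)) (k := k + 1)
    (by rw [Finset.card_insert_of_notMem hmem]; simpa using hS)
  rw [Finset.sum_insert hmem] at this
  simp at this
  linarith

/-- The contour is placed at distance `δ` beyond the convergence bound of the lower rank. The
inequalities involving the last parameter hold because adjoining it to a choice of at most `j`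
others gives at most `j + 1` parameters. -/
theorem liftRegion_of_topSum {n : ℕ} (ν s : Fin (n + 1) → ℂ) {δ : ℝ} (hδ : 0 < δ)
    (hs : ∀ j : Fin (n + 1), topSum ν (j + 1) + δ < (s j).re) :
    LiftRegion (ν (Fin.last n)) s
      fun j : Fin n => -(topSum (fun i : Fin n => ν i.castSucc) (j + 1) + δ) := by
  set τ : Fin n → ℝ := fun j => -(topSum (fun i : Fin n => ν i.castSucc) (j + 1) + δ) with hτ
  have hcons : ∀ j : Fin (n + 1), -(Fin.cons 0 τ : Fin (n + 1) → ℝ) j ≤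
      topSum (fun i : Fin n => ν i.castSucc) j + δ := fun j => by
    refine Fin.cases ?_ (fun j => ?_) j
    · have := topSum_nonneg (fun i : Fin n => ν i.castSucc) 0
      simp only [Fin.cons_zero, Fin.val_zero]
      linarith
    · simp [hτ]
  have hadd := fun j : Fin (n + 1) => topSum_castSucc_add_le ν j
  refine ⟨fun j => ?_, fun j => ?_, fun j => ?_, fun j => ?_⟩
  · linarith [hcons j, hadd j, hs j, le_abs_self (ν (Fin.last n)).re]
  · linarith [hcons j, hadd j, hs j, neg_abs_le (ν (Fin.last n)).re]
  · have h1 := hs j.castSucc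
    have h2 := topSum_castSucc_le ν (j + 1)
    simp only [Fin.val_castSucc, hτ, neg_neg] at h1 ⊢
    linarith
  · have h1 := hs j.succ
    have h2 := topSum_castSucc_le ν j
    have h3 := topSum_mono ν (show (j : ℕ) ≤ j + 1 + 1 by omega)
    have h4 := hcons j.castSucc
    simp only [Fin.val_succ, Fin.val_castSucc] at h1 h4
    linarith

/-- Induction on the rank: the lift theorem reduces convergence to the lower rank transform at the
points `topSum + δ`, which again lie strictly inside its region. -/
theorem whittakerMellinConvergent_of_topSum : ∀ (n : ℕ) (ν s : Fin (n + 1) → ℂ),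
    (∀ j : Fin (n + 1), topSum ν (j + 1) < (s j).re) → WhittakerMellinConvergent (n + 1) ν s
  | 0, ν, s, hs => by
    refine (whittaker_one_mellin ν s ?_).1
    have := le_topSum ν (S := {0}) (k := 1) (by simp)
    simp at this
    exact this.trans_lt (by simpa using hs 0)
  | n + 1, ν, s, hs => by
    obtain ⟨δ, hδ, hδs⟩ : ∃ δ > 0, ∀ j : Fin (n + 2), topSum ν (j + 1) + δ < (s j).re := by
      obtain ⟨j₀, hj₀⟩ := Finite.exists_min fun j : Fin (n + 2) => (s j).re - topSum ν (j + 1)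
      -- Half of the smallest slack keeps all finitely many inequalities strict.
      refine ⟨((s j₀).re - topSum ν (j₀ + 1)) / 2, by linarith [hs j₀], fun j => ?_⟩
      linarith [hj₀ j, hs j₀]
    refine ((liftRegion_of_topSum ν s hδ hδs).whittaker_mellin ?_).1
    refine whittakerMellinConvergent_of_topSum n _ _ fun j => ?_
    simp only [Complex.ofReal_neg, neg_neg, Complex.ofReal_re]
    linarith

/-- Choosing each sign opposite to that of the real part turns the signed sum into minus a sum of
absolute values; enlarging `S` to exactly `j + 1` elements only lowers it. -/
theorem exists_signed_sum_eq {n : ℕ} (ν : Fin n → ℂ) (j : Fin n) {S : Finset (Fin n)}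
    (hS : S.card ≤ j + 1) : ∃ (ε : Fin n → ℤˣ) (σ : Equiv.Perm (Fin n)),
      (∑ i : Fin n with i ≤ j, ((ε i : ℤ) : ℂ) * ν (σ i)).re ≤ -∑ i ∈ S, |(ν i).re| := by
  obtain ⟨S', hSS', hcard⟩ : ∃ S', S ⊆ S' ∧ S'.card = j + 1 := by
    obtain ⟨S', h1, -, h2⟩ := Finset.exists_subsuperset_card_eq (Finset.subset_univ S) hS
      (by simp)
    exact ⟨S', h1, h2⟩
  have hI : (Finset.univ.filter fun i : Fin n => i ≤ j).card = j + 1 := by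
    rw [← Fin.card_Iic j]
    congr 1
    ext i
    simp
  obtain ⟨σ, hσ⟩ : ∃ σ : Equiv.Perm (Fin n),
      (Finset.univ.filter fun i : Fin n => i ≤ j).map σ.toEmbedding = S' := by
    -- A bijection from the initial segment onto `S'` extends to a permutation of the finite index
    -- set.
    let e : {x // x ∈ Finset.univ.filter fun i : Fin n => i ≤ j} ≃ {x // x ∈ S'} :=
      Fintype.equivOfCardEq (by simp only [Fintype.card_coe, hI, hcard])
    refine ⟨e.extendSubtype, ?_⟩
    refine Finset.eq_of_subset_of_card_le ?_ (by rw [Finset.card_map, hI, hcard])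
    intro x hx
    obtain ⟨i, hi, rfl⟩ := Finset.mem_map.1 hx
    exact e.extendSubtype_mem i hi
  refine ⟨fun i => if 0 ≤ (ν (σ i)).re then -1 else 1, σ, ?_⟩
  have hterm : ∀ i : Fin n, ((((if 0 ≤ (ν (σ i)).re then -1 else 1 : ℤˣ) : ℤ) : ℂ) *
      ν (σ i)).re = -|(ν (σ i)).re| := fun i => by
    split_ifs with h
    · simp [abs_of_nonneg h]
    · simp [abs_of_neg (not_le.1 h)]
  rw [Complex.re_sum, Finset.sum_congr rfl fun i _ => hterm i, Finset.sum_neg_distrib,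
    neg_le_neg_iff]
  refine (Finset.sum_le_sum_of_subset_of_nonneg hSS' fun i _ _ => abs_nonneg _).trans_eq ?_
  rw [← hσ, Finset.sum_map]
  rfl

/-- The rank is `n + 2 ≥ 2` in the recursion; the first conjunct is the rank one case. -/
theorem theorem4p2 :
    (∀ ν s : Fin 1 → ℂ, |(ν 0).re| < (s 0).re →
      WhittakerMellinConvergent 1 ν s ∧
      whittakerMellin 1 ν s = 2⁻¹ * Complex.Gamma (s 0 + ν 0) * Complex.Gamma (s 0 - ν 0)) ∧
    (∀ (n : ℕ) (ν : Fin (n + 2) → ℂ) (τ : Fin (n + 1) → ℝ),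
      (∀ (j : Fin (n + 1)) (ε : Fin (n + 2) → ℤˣ) (σ : Equiv.Perm (Fin (n + 2))),
        τ j < (∑ i : Fin (n + 2) with i ≤ j.castSucc, ((ε i : ℤ) : ℂ) * ν (σ i)).re) →
      (∀ t : Fin (n + 1) → ℂ, (∀ j, (t j).re = τ j) →
        WhittakerMellinConvergent (n + 1) (fun i => ν i.castSucc) (fun i => -t i)) ∧
      ∀ s ∈ mellinRegion n ν τ,
        WhittakerMellinConvergent (n + 2) ν s ∧
        VerticalIntegrable τ (barnesIntegrand n ν s) ∧
        whittakerMellin (n + 2) ν s =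
          2⁻¹ / (2 * (Real.pi : ℂ) * Complex.I) ^ (n + 1) *
            verticalIntegral τ (barnesIntegrand n ν s)) := by
  refine ⟨whittaker_one_mellin, fun n ν τ hτ => ?_⟩
  have hconv : WhittakerMellinConvergent (n + 1) (fun i => ν i.castSucc)
      fun i => -(τ i : ℂ) := by
    refine whittakerMellinConvergent_of_topSum n _ _ fun j => ?_
    -- Testing the hypothesis on the signed sum for a maximising `S` gives `τ_j < -topSum ν (j +
    -- 1)`; dropping the last parameter can only decrease `topSum`.
    obtain ⟨S, hS, hsum⟩ := exists_topSum ν (j + 1)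
    obtain ⟨ε, σ, hle⟩ := exists_signed_sum_eq ν j.castSucc (S := S) (by simpa using hS)
    have h1 := hτ j ε σ
    have h2 := topSum_castSucc_le ν (j + 1)
    simp only [Complex.neg_re, Complex.ofReal_re]
    linarith
  refine ⟨fun t ht => whittakerMellinConvergent_congr_re (fun i => by simp [ht]) hconv,
    fun s hs => ?_⟩
  obtain ⟨h1, h2, h3⟩ := hs
  exact LiftRegion.whittaker_mellin ⟨fun j => (h1 j).1, fun j => (h1 j).2, h2, h3⟩ hconv
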